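/- **Setting.** Let $K\ge 2$ be the number of arms, $T>K$ the horizon, and let $(X^k_t)_{t\in[T]}$, $k\in[K]$, be $[0,1]$-valued processes on one probability space, each weakly stationary, with means $\mu_k=\mathbb E[X^k_t]$ and $\mu_\star=\max_k\mu_k$. (The arms may depend on each other.) Let $\mathcal F_i$ be the $\sigma$-algebra generated by the outcomes of all arms at times $1,\dots,i$. Let $C$ be a seminorm on a linear space $\mathcal C$ of bounded measurable functions on $[0,1]$, let $\mathcal C_1=\{f\in\mathcal C: C(f)\le 1\}$, and assume that the identity $x\mapsto x$ is in $\mathcal C_1$. The mixing coefficients of arm $k$ are $$\Phi^k_{\mathcal C}(n)=\sup\big\{\|\mathbb E[\varphi(X^k_{i+n})\mid\mathcal F_i]-\mathbb E[\varphi(X^k_{i+n})]\|_{\infty}:\ \varphi\in\mathcal C_1,\ i\ge 1,\ i+n\le T\big\}.$$ *Fast mixing scenario:* $\Phi^k_{\mathcal C}(n)\le n^{-\alpha}$ for all arms $k$ and all $n\ge1$, where $\alpha>\tfrac12$ is fixed. A number $c$ is called *admissible* (for $\alpha$) if $$\sum_{j=1}^n j^{-3/2}\sum_{k=1}^j k^{-\alpha}\le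 c\sum_{j=1}^n j^{-1/2-\alpha}\quad\text{for all } n\in\mathbb N,$$ and we put $M(c)=80\,c\sum_{j\ge1}j^{-1/2-\alpha}$. **Algorithm (Improved UCB with dependence factor $M=M(c)$).** Let $\mathcal A=4\sqrt e$, $\theta_s=2^{-s}$, $n_s=\big\lceil 8(1+M)^2\log(\mathcal A T\theta_s^2)/\theta_s^2\big\rceil$ and $\Omega_s=(1+M)\sqrt{2\log(\mathcal A T\theta_s^2)/n_s}$. Start at time $1$ with all arms active, $B_0=[K]$. In epoch $s=0,1,2,\dots$ every arm of $B_s$ is pulled exactly $n_s$ times, in an arbitrary fixed order, which may depend on $s$ and $B_s$. With $\hat\mu_{i,s}$ the average of the rewards collected from arm $i$ in epoch $s$, every arm $i\in B_s$ with $\hat\mu_{i,s}+\Omega_s\le\max_{j\in B_s}\hat\mu_{j,s}-\Omega_s$ is then discarded, which gives $B_{s+1}$. The procedure stops when the horizon $T$ is reached. Let $I_t$ be the arm pulled at time $t$ and $R(T)=\mathbb E\big[\sum_{t=1}^T(\mu_\star-\mu_{I_t})\big]$ the pseudo-regret. **Theorem.** Let $\alpha>\tfrac12$. Admissible constants exist.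 For every admissible $c$ there is a constant $c_\alpha\ge c$, depending only on $\alpha$ and $c$ (not on $K$, $T$, the pulling orders, $(\mathcal C,C)$, or the distribution of the arms), such that, with $M_\alpha=M(c_\alpha)=80\,c_\alpha\sum_{j\ge1}j^{-1/2-\alpha}$, Improved UCB with dependence factor $M(c)$ satisfies in the fast mixing scenario the problem-independent bound $$R(T)\le\sqrt{(1+M_\alpha)KT}\;\frac{\log(K\log K)}{\sqrt{\log K}}$$ for all $K\ge2$ and $T>K$. -/

import Mathlib

open MeasureTheory ProbabilityTheory
open scoped ENNReal

noncomputable section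

namespace MixingBandit

/-! ### Weak mixing with respect to a seminorm -/

/-- A linear space `𝒞` of bounded measurable functions on `[0,1]` with a seminorm `C` on it.
(No completeness is required.) -/
structure TestClass where
  space : Submodule ℝ (unitInterval → ℝ)
  seminorm : Seminorm ℝ space
  measurable : ∀ f ∈ space, Measurable f
  bounded : ∀ f ∈ space, ∃ b : ℝ, ∀ x, |f x| ≤ b

/-- The unit ball `𝒞₁ = {f ∈ 𝒞 : C(f) ≤ 1}`. -/
def TestClass.unitBall (C : TestClass) : Set (unitInterval → ℝ) :=
  {f | ∃ h : f ∈ C.space, C.seminorm ⟨f, h⟩ ≤ 1}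

section Arms

variable {Ω : Type*} [MeasurableSpace Ω] {K : ℕ}

/-- `𝓕_i`, the σ-algebra generated by the outcomes of all arms at the times `1, …, i`. -/
@[reducible] def history (X : Fin K → ℕ → Ω → unitInterval) (i : ℕ) : MeasurableSpace Ω :=
  ⨆ k : Fin K, ⨆ j ∈ Finset.Icc 1 i, MeasurableSpace.comap (X k j) inferInstance

/-- The mixing coefficient `Φ_𝒞(n)` of arm `k` on the time window `1, …, T`: the supremum over
`φ ∈ 𝒞₁` and `i ≥ 1` of the `L^∞` norm of `E[φ(X_{i+n}) | 𝓕_i] - E[φ(X_{i+n})]`. -/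
def mixingCoeff (P : Measure Ω) (C : TestClass) (X : Fin K → ℕ → Ω → unitInterval) (T : ℕ)
    (k : Fin K) (n : ℕ) : ℝ≥0∞ :=
  ⨆ φ ∈ C.unitBall, ⨆ (i : ℕ) (_ : 1 ≤ i ∧ i + n ≤ T),
    eLpNorm (fun ω => (P[fun ω' => φ (X k (i + n) ω') | history X i]) ω
      - ∫ ω', φ (X k (i + n) ω') ∂P) ∞ P

/-- Every arm is `𝒞`-mixing with rate `Φ_𝒞(n) ≤ n^{-α}`. -/
def MixesAtRate (P : Measure Ω) (C : TestClass) (X : Fin K → ℕ → Ω → unitInterval) (T : ℕ)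
    (α : ℝ) : Prop :=
  ∀ k : Fin K, ∀ n : ℕ, 1 ≤ n → mixingCoeff P C X T k n ≤ ENNReal.ofReal ((n : ℝ) ^ (-α))

/-- Every arm is weakly stationary on the times `1, …, T`: constant mean, shift-invariant
covariances. -/
def WeaklyStationary (P : Measure Ω) (X : Fin K → ℕ → Ω → unitInterval) (T : ℕ) : Prop :=
  ∀ k : Fin K,
    (∀ s ∈ Finset.Icc 1 T, ∀ t ∈ Finset.Icc 1 T,
      ∫ ω, (X k s ω : ℝ) ∂P = ∫ ω, (X k t ω : ℝ) ∂P) ∧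
    (∀ s t h : ℕ, 1 ≤ s → 1 ≤ t → s + h ≤ T → t + h ≤ T →
      cov[fun ω => (X k (s + h) ω : ℝ), fun ω => (X k (t + h) ω : ℝ); P] =
        cov[fun ω => (X k s ω : ℝ), fun ω => (X k t ω : ℝ); P])

/-- The mean `μ_k` of arm `k`. -/
def armMean (P : Measure Ω) (X : Fin K → ℕ → Ω → unitInterval) (k : Fin K) : ℝ :=
  ∫ ω, (X k 1 ω : ℝ) ∂P

/-- The pseudo-regret `E[∑_{t=1}^T (μ_⋆ - μ_{I_t})]` of the decisions `I_t`. -/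
def pseudoRegret (P : Measure Ω) (X : Fin K → ℕ → Ω → unitInterval) (T : ℕ)
    (I : ℕ → Ω → Fin K) : ℝ :=
  ∫ ω, ∑ t ∈ Finset.Icc 1 T, ((⨆ k, armMean P X k) - armMean P X (I t ω)) ∂P

end Arms

/-! ### The constants of the fast mixing scenario -/

/-- `c` is an admissible constant `c_α`:
`∑_{j≤n} j^{-3/2} ∑_{k≤j} k^{-α} ≤ c ∑_{j≤n} j^{-1/2-α}` for all `n`. -/
def IsDependenceConstant (α c : ℝ) : Prop :=
  ∀ n : ℕ, ∑ j ∈ Finset.Icc 1 n, (j : ℝ) ^ (-(3 / 2) : ℝ) * ∑ k ∈ Finset.Icc 1 j, (k : ℝ) ^ (-α)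
    ≤ c * ∑ j ∈ Finset.Icc 1 n, (j : ℝ) ^ (-(1 / 2) - α : ℝ)

/-- `M = 80 c ∑_{j≥1} j^{-1/2-α}`. -/
def depFactor (α c : ℝ) : ℝ := 80 * c * ∑' j : ℕ, ((j + 1 : ℕ) : ℝ) ^ (-(1 / 2) - α : ℝ)

/-! ### Improved UCB -/

/-- `θ_s = 2^{-s}`. -/
def theta (s : ℕ) : ℝ := (1 / 2) ^ s

/-- `log(𝒜 T θ_s²)` with `𝒜 = 4√e`. -/
def logTerm (T s : ℕ) : ℝ := Real.log (4 * √(Real.exp 1) * T * theta s ^ 2)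

/-- The number of pulls of each active arm in epoch `s`, namely
`⌈8 (1+M)² log(𝒜 T θ_s²) / θ_s²⌉`; it makes the confidence radius at most `θ_s / 2`. -/
def pulls (M : ℝ) (T s : ℕ) : ℕ := ⌈8 * (1 + M) ^ 2 * logTerm T s / theta s ^ 2⌉₊

/-- The confidence radius `(1+M) √(2 log(𝒜 T θ_s²) / n_s)` of epoch `s`. -/
def radius (M : ℝ) (T s : ℕ) : ℝ := (1 + M) * √(2 * logTerm T s / pulls M T s)

/-- A deterministic pulling order: `arm s B p` is the arm pulled at position `p` of epoch `s`, if
`B` is the set of active arms. In the `|B| n_s` steps of the epoch every active arm is pulled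
exactly `n_s` times (so no other arm is pulled). -/
structure PullingOrder (K : ℕ) (n : ℕ → ℕ) where
  arm : ℕ → Finset (Fin K) → ℕ → Fin K
  balanced : ∀ (s : ℕ) (B : Finset (Fin K)), ∀ i ∈ B,
    ((Finset.range (B.card * n s)).filter (fun p => arm s B p = i)).card = n s

variable {K : ℕ}

/-- The average of the rewards collected from arm `i` during epoch `s`, when the epoch starts at
time `τ` with active set `B`. -/
def epochAverage {n : ℕ → ℕ} (π : PullingOrder K n) (x : Fin K → ℕ → ℝ) (s τ : ℕ)
    (B : Finset (Fin K)) (i : Fin K) : ℝ :=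
  (∑ p ∈ (Finset.range (B.card * n s)).filter (fun p => π.arm s B p = i), x i (τ + p)) / n s

open Classical in
/-- The starting time and the active set `(τ_s, B_s)` of epoch `s` on the reward table `x`. An arm
`i ∈ B_s` is discarded if `μ̂_i + Ω_s ≤ max_{j ∈ B_s} μ̂_j - Ω_s`. -/
def epoch (M : ℝ) (T : ℕ) (π : PullingOrder K (pulls M T)) (x : Fin K → ℕ → ℝ) :
    ℕ → ℕ × Finset (Fin K)
  | 0 => (1, Finset.univ)
  | s + 1 =>
    let τ := (epoch M T π x s).1
    let B := (epoch M T π x s).2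
    (τ + B.card * pulls M T s,
      B.filter (fun i => ¬ ∃ j ∈ B,
        epochAverage π x s τ B i + radius M T s ≤ epochAverage π x s τ B j - radius M T s))

/-- The index of the epoch that contains time `t`. -/
def epochAt (M : ℝ) (T : ℕ) (π : PullingOrder K (pulls M T)) (x : Fin K → ℕ → ℝ) (t : ℕ) : ℕ :=
  Nat.findGreatest (fun s => (epoch M T π x s).1 ≤ t) t

/-- The arm `I_t` which Improved UCB pulls at time `t`, `1 ≤ t ≤ T`, on the reward table `x`. -/
def improvedUCB (M : ℝ) (T : ℕ) (π : PullingOrder K (pulls M T)) (x : Fin K → ℕ → ℝ)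
    (t : ℕ) : Fin K :=
  let s := epochAt M T π x t
  π.arm s (epoch M T π x s).2 (t - (epoch M T π x s).1)

end MixingBandit

end

/-! The probabilistic core is a Hoeffding-type inequality for dependent rewards. At the successive
pulls of one arm, the centred reward of the pull i places ahead has conditional mean at most
(i+1)^(-α) given the past. Subtracting conditional means leaves bounded martingale differences plus
a predictable sequence. Neighbours of that sequence are paired, the second of each pair is replaced
by its conditional expectation given the past of the first, and the pairs form a predictable
sequence of half the length over a coarser filtration (`exists_isSubGaussianOn_sum_predictable`). At
level l the terms are conditional sums over blocks of length 2^l, hence at most a_l = ∑_{i≤2^l}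
i^(-α), and the Azuma-Hoeffding bound gives a standard deviation of order a_l √(n/2^l). The total,
√n ∑_l a_l/√(2^l), is controlled by ∑_j j^(-3/2) ∑_{k≤j} k^(-α), hence by M. The halvings end in one
variable, bounded by a multiple of M√n.

The start and the active set of an epoch are random, but {(τ_s, B_s) = (t, B)} belongs to the
history before t. Exponential moments are therefore bounded on an event E of the initial σ-algebra,
with the factor P(E); summing over the disjoint events leaves a union bound over at most K arms
(`measure_badEpoch_le`).

Pathwise, as long as epochs are good, the best arm survives and the arms active in epoch s have gap
at most 4θ_s (`active_gap_le`). A cutoff S with Tθ_S² of order K log K makes the regret O((1+M)²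
√(KT log K)). Finally √(log K) ≤ 4 log(K log K)/√(log K), and the remaining factor, which depends on
α and c only, is absorbed by enlarging c_α. -/

namespace MixingBandit

/-! ### Exponential moments on an event and the Azuma-Hoeffding bound. -/

section SubGaussian

variable {Ω : Type*} {m0 : MeasurableSpace Ω} {P : Measure Ω}

/-- On the event `E`, the exponential moments of `f` are those of a Gaussian with standard
deviation `σ`. -/
def IsSubGaussianOn (P : Measure Ω) (E : Set Ω) (f : Ω → ℝ) (σ : ℝ) : Prop :=
  ∀ l : ℝ, Integrable (fun ω => Real.exp (l * f ω)) P ∧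
    ∫ ω in E, Real.exp (l * f ω) ∂P ≤ Real.exp (l ^ 2 * σ ^ 2 / 2) * P.real E

lemma IsSubGaussianOn.mono {E : Set Ω} {f : Ω → ℝ} {σ τ : ℝ} (h : IsSubGaussianOn P E f σ)
    (hσ : 0 ≤ σ) (hστ : σ ≤ τ) : IsSubGaussianOn P E f τ := fun l =>
  ⟨(h l).1, (h l).2.trans (by gcongr)⟩

lemma IsSubGaussianOn.congr {E : Set Ω} {f g : Ω → ℝ} {σ : ℝ} (h : IsSubGaussianOn P E f σ)
    (hfg : f =ᵐ[P] g) : IsSubGaussianOn P E g σ := fun l => by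
  have h1 : (fun ω => Real.exp (l * f ω)) =ᵐ[P] fun ω => Real.exp (l * g ω) := by
    filter_upwards [hfg] with ω hω
    rw [hω]
  refine ⟨(h l).1.congr h1, ?_⟩
  rw [← integral_congr_ae (ae_restrict_of_ae h1)]
  exact (h l).2

lemma isSubGaussianOn_zero [IsFiniteMeasure P] (E : Set Ω) (σ : ℝ) :
    IsSubGaussianOn P E (fun _ => 0) σ := fun l => by
  refine ⟨by simp, ?_⟩
  simp only [mul_zero, Real.exp_zero, integral_const, measureReal_restrict_apply_univ,
    smul_eq_mul, mul_one]
  exact le_mul_of_one_le_left measureReal_nonneg (Real.one_le_exp (by positivity))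

lemma IsSubGaussianOn.neg {E : Set Ω} {f : Ω → ℝ} {σ : ℝ} (h : IsSubGaussianOn P E f σ) :
    IsSubGaussianOn P E (fun ω => - f ω) σ := fun l => by
  simpa using h (-l)

/-- Convexity of `exp` with weights σ/(σ+τ) and τ/(σ+τ) replaces independence; the price is that
standard deviations add instead of variances. -/
lemma IsSubGaussianOn.add {E : Set Ω} {f g : Ω → ℝ} {σ τ : ℝ} (hf : IsSubGaussianOn P E f σ)
    (hg : IsSubGaussianOn P E g τ) (hσ : 0 < σ) (hτ : 0 < τ) :
    IsSubGaussianOn P E (fun ω => f ω + g ω) (σ + τ) := fun l => by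
  have hs : 0 < σ + τ := by positivity
  obtain ⟨hf1, hf2⟩ := hf (l * (σ + τ) / σ)
  obtain ⟨hg1, hg2⟩ := hg (l * (σ + τ) / τ)
  have key : ∀ ω, Real.exp (l * (f ω + g ω)) ≤
      σ / (σ + τ) * Real.exp (l * (σ + τ) / σ * f ω)
        + τ / (σ + τ) * Real.exp (l * (σ + τ) / τ * g ω) := fun ω => by
    have := convexOn_exp.2 (Set.mem_univ (l * (σ + τ) / σ * f ω))
      (Set.mem_univ (l * (σ + τ) / τ * g ω))
      (show 0 ≤ σ / (σ + τ) by positivity) (show 0 ≤ τ / (σ + τ) by positivity) (by field_simp)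
    simp only [smul_eq_mul] at this
    refine le_trans (le_of_eq ?_) this
    congr 1
    field_simp
  have hint := (hf1.const_mul (σ / (σ + τ))).add (hg1.const_mul (τ / (σ + τ)))
  have hint1 : Integrable (fun ω => Real.exp (l * (f ω + g ω))) P := by
    refine hint.mono' ?_ (ae_of_all _ fun ω => ?_)
    · have := (hf l).1.aestronglyMeasurable.mul (hg l).1.aestronglyMeasurable
      refine this.congr (ae_of_all _ fun ω => ?_)
      simp [mul_add, Real.exp_add]
    · rw [Real.norm_of_nonneg (Real.exp_nonneg _)]
      exact key ω
  refine ⟨hint1, ?_⟩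
  calc ∫ ω in E, Real.exp (l * (f ω + g ω)) ∂P
      ≤ ∫ ω in E, (σ / (σ + τ) * Real.exp (l * (σ + τ) / σ * f ω)
        + τ / (σ + τ) * Real.exp (l * (σ + τ) / τ * g ω)) ∂P :=
        integral_mono hint1.integrableOn hint.integrableOn key
    _ = σ / (σ + τ) * ∫ ω in E, Real.exp (l * (σ + τ) / σ * f ω) ∂P
        + τ / (σ + τ) * ∫ ω in E, Real.exp (l * (σ + τ) / τ * g ω) ∂P := by
        rw [integral_add (hf1.const_mul _).integrableOn (hg1.const_mul _).integrableOn,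
          integral_const_mul, integral_const_mul]
    _ ≤ σ / (σ + τ) * (Real.exp ((l * (σ + τ) / σ) ^ 2 * σ ^ 2 / 2) * P.real E)
        + τ / (σ + τ) * (Real.exp ((l * (σ + τ) / τ) ^ 2 * τ ^ 2 / 2) * P.real E) := by
        gcongr
    _ = Real.exp (l ^ 2 * (σ + τ) ^ 2 / 2) * P.real E := by
        have e1 : (l * (σ + τ) / σ) ^ 2 * σ ^ 2 / 2 = l ^ 2 * (σ + τ) ^ 2 / 2 := by field_simp
        have e2 : (l * (σ + τ) / τ) ^ 2 * τ ^ 2 / 2 = l ^ 2 * (σ + τ) ^ 2 / 2 := by field_simp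
        rw [e1, e2]
        field_simp

lemma IsSubGaussianOn.measure_ge_le [IsFiniteMeasure P] {E : Set Ω} {f : Ω → ℝ} {σ x : ℝ}
    (h : IsSubGaussianOn P E f σ) (hσ : 0 < σ) (hx : 0 ≤ x) :
    P.real (E ∩ {ω | x ≤ f ω}) ≤ Real.exp (-(x ^ 2 / (2 * σ ^ 2))) * P.real E := by
  -- The exponent that optimises the Chernoff bound.
  obtain ⟨h1, h2⟩ := h (x / σ ^ 2)
  have hmark := mul_meas_ge_le_integral_of_nonneg (μ := P.restrict E)
    (f := fun ω => Real.exp (x / σ ^ 2 * f ω)) (ae_of_all _ fun ω => (Real.exp_nonneg _))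
    h1.integrableOn (Real.exp (x / σ ^ 2 * x))
  have hsub : P.real (E ∩ {ω | x ≤ f ω}) ≤
      (P.restrict E).real {ω | Real.exp (x / σ ^ 2 * x) ≤ Real.exp (x / σ ^ 2 * f ω)} := by
    refine ENNReal.toReal_mono (measure_ne_top _ _) ?_
    refine le_trans ?_ (Measure.le_restrict_apply _ _)
    refine measure_mono fun ω hω => ⟨?_, hω.1⟩
    have := hω.2
    simp only [Set.mem_ofPred_eq] at this ⊢
    gcongr
  have h3 := (mul_le_mul_of_nonneg_left hsub (Real.exp_nonneg (x / σ ^ 2 * x))).trans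
    (hmark.trans h2)
  have h4 : Real.exp (-(x ^ 2 / (2 * σ ^ 2))) =
      (Real.exp (x / σ ^ 2 * x))⁻¹ * Real.exp ((x / σ ^ 2) ^ 2 * σ ^ 2 / 2) := by
    rw [← Real.exp_neg, ← Real.exp_add]
    congr 1
    field_simp
    ring
  rw [h4, mul_assoc]
  rwa [← div_eq_inv_mul, le_div_iff₀' (Real.exp_pos _)]

/-- A convex function lies below its chord over [-d, d]. -/
lemma exp_le_cosh_add {x d : ℝ} (hd : 0 < d) (hx : |x| ≤ d) :
    Real.exp x ≤ Real.cosh d + Real.sinh d / d * x := by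
  obtain ⟨h1, h2⟩ := abs_le.mp hx
  have := convexOn_exp.2 (Set.mem_univ d) (Set.mem_univ (-d))
    (show 0 ≤ (d + x) / (2 * d) from div_nonneg (by linarith) (by positivity))
    (show 0 ≤ (d - x) / (2 * d) from div_nonneg (by linarith) (by positivity))
    (by field_simp; ring)
  simp only [smul_eq_mul] at this
  rw [Real.cosh_eq, Real.sinh_eq]
  have e1 : (d + x) / (2 * d) * d + (d - x) / (2 * d) * -d = x := by field_simp; ring
  rw [e1] at this
  refine this.trans (le_of_eq ?_)
  field_simp
  ring

/-- The exponential moment bound of Azuma and Hoeffding for martingale differences. -/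
lemma integral_exp_sum_martingaleDiff_le [IsFiniteMeasure P] {G : ℕ → MeasurableSpace Ω}
    (hG : Monotone G) (hle : ∀ j, G j ≤ m0) {D : ℕ → Ω → ℝ} {d : ℝ} (hd : 0 < d)
    (hD : ∀ j, StronglyMeasurable[G (j + 1)] (D j)) (hb : ∀ j, ∀ᵐ ω ∂P, |D j ω| ≤ d)
    (hzero : ∀ j, P[D j | G j] =ᵐ[P] 0) {E : Set Ω} (hE : MeasurableSet[G 0] E) (m : ℕ) :
    Integrable (fun ω => Real.exp (∑ j ∈ Finset.range m, D j ω)) P ∧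
    ∫ ω in E, Real.exp (∑ j ∈ Finset.range m, D j ω) ∂P ≤
      Real.exp (m * d ^ 2 / 2) * P.real E := by
  have hmeas : ∀ m, StronglyMeasurable[G m] (fun ω => Real.exp (∑ j ∈ Finset.range m, D j ω)) := by
    intro m
    refine Real.continuous_exp.comp_stronglyMeasurable ?_
    refine Finset.stronglyMeasurable_fun_sum _ fun j hj => (hD j).mono (hG ?_)
    have := Finset.mem_range.mp hj
    omega
  have hbd : ∀ m, ∀ᵐ ω ∂P, ‖Real.exp (∑ j ∈ Finset.range m, D j ω)‖ ≤ Real.exp (m * d) := by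
    intro m
    filter_upwards [ae_all_iff.mpr hb] with ω hω
    rw [Real.norm_of_nonneg (Real.exp_nonneg _)]
    gcongr
    calc _ ≤ ∑ j ∈ Finset.range m, d := Finset.sum_le_sum fun j _ => (le_abs_self _).trans (hω j)
      _ = m * d := by simp
  have hint : ∀ m, Integrable (fun ω => Real.exp (∑ j ∈ Finset.range m, D j ω)) P := fun m =>
    Integrable.of_bound ((hmeas m).mono (hle m)).aestronglyMeasurable _ (hbd m)
  refine ⟨hint m, ?_⟩
  induction m with
  | zero => simp
  | succ m ih =>
    have hDint : Integrable (D m) P :=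
      Integrable.of_bound ((hD m).mono (hle _)).aestronglyMeasurable d (hb m)
    set W : Ω → ℝ := fun ω => Real.exp (∑ j ∈ Finset.range m, D j ω) with hW
    have hWD : Integrable (fun ω => W ω * D m ω) P :=
      hDint.bdd_mul ((hmeas m).mono (hle m)).aestronglyMeasurable (hbd m)
    -- The linear term of the chord vanishes on E: the weight W is known at stage m and E belongs to
    -- `G m`.
    have hnull : ∫ ω in E, W ω * D m ω ∂P = 0 := by
      rw [← setIntegral_condExp (hle m) hWD (hG (Nat.zero_le m) E hE)]
      have h1 : P[fun ω => W ω * D m ω | G m] =ᵐ[P] 0 := by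
        have := condExp_mul_of_stronglyMeasurable_left (hmeas m) hWD hDint
        filter_upwards [this, hzero m] with ω h1 h2
        have h1' : (P[fun ω => W ω * D m ω | G m]) ω = W ω * (P[D m | G m]) ω := h1
        rw [h1', h2]
        simp
      rw [integral_congr_ae (ae_restrict_of_ae h1)]
      simp
    calc ∫ ω in E, Real.exp (∑ j ∈ Finset.range (m + 1), D j ω) ∂P
        ≤ ∫ ω in E, (Real.cosh d * W ω + Real.sinh d / d * (W ω * D m ω)) ∂P := by
          refine integral_mono_ae (hint _).integrableOn
            ((hint m).const_mul _ |>.add (hWD.const_mul _)).integrableOn ?_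
          refine ae_restrict_of_ae ?_
          filter_upwards [hb m] with ω hω
          simp only [Finset.sum_range_succ, Real.exp_add]
          have := mul_le_mul_of_nonneg_left (exp_le_cosh_add hd hω)
            (Real.exp_nonneg (∑ j ∈ Finset.range m, D j ω))
          refine this.trans (le_of_eq ?_)
          simp only [hW]
          ring
      _ = Real.cosh d * ∫ ω in E, W ω ∂P := by
          rw [integral_add ((hint m).const_mul _).integrableOn (hWD.const_mul _).integrableOn,
            integral_const_mul, integral_const_mul, hnull]
          ring
      _ ≤ Real.exp (d ^ 2 / 2) * (Real.exp (m * d ^ 2 / 2) * P.real E) := by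
          refine mul_le_mul (Real.cosh_le_exp_half_sq d) ih ?_ (Real.exp_nonneg _)
          exact setIntegral_nonneg (hle 0 E hE) fun ω _ => Real.exp_nonneg _
      _ = Real.exp ((m + 1 : ℕ) * d ^ 2 / 2) * P.real E := by
          rw [← mul_assoc, ← Real.exp_add]
          congr 2
          push_cast
          ring

lemma isSubGaussianOn_martingaleDiff [IsFiniteMeasure P] {G : ℕ → MeasurableSpace Ω}
    (hG : Monotone G) (hle : ∀ j, G j ≤ m0) {D : ℕ → Ω → ℝ} {d : ℝ} (hd : 0 < d)
    (hD : ∀ j, StronglyMeasurable[G (j + 1)] (D j)) (hb : ∀ j, ∀ᵐ ω ∂P, |D j ω| ≤ d)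
    (hzero : ∀ j, P[D j | G j] =ᵐ[P] 0) {E : Set Ω} (hE : MeasurableSet[G 0] E) (m : ℕ) :
    IsSubGaussianOn P E (fun ω => ∑ j ∈ Finset.range m, D j ω) (√m * d) := by
  intro l
  -- The rescaled differences need a strictly positive bound |l| d.
  rcases eq_or_ne l 0 with rfl | hl
  · refine ⟨by simp, by simp⟩
  have := integral_exp_sum_martingaleDiff_le (P := P) hG hle (D := fun j ω => l * D j ω)
    (d := |l| * d) (by positivity) (fun j => (hD j).const_mul l)
    (fun j => by
      filter_upwards [hb j] with ω hω
      rw [abs_mul]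
      gcongr)
    (fun j => by
      have h1 := condExp_smul (μ := P) l (D j) (G j)
      filter_upwards [h1, hzero j] with ω h1 h2
      have h1' : (P[fun ω => l * D j ω | G j]) ω = l * (P[D j | G j]) ω := h1
      rw [h1', h2]
      simp) hE m
  simp only [← Finset.mul_sum] at this
  refine ⟨this.1, this.2.trans (le_of_eq ?_)⟩
  congr 2
  rw [mul_pow, mul_pow, Real.sq_sqrt (Nat.cast_nonneg m), sq_abs]
  ring

end SubGaussian

/-! ### Dyadic martingale approximation. -/

section Dyadic

variable {Ω : Type*} {m0 : MeasurableSpace Ω} {P : Measure Ω}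

lemma condExp_sum_condExp [IsFiniteMeasure P] {ι : Type*} (s : Finset ι) {f : ι → Ω → ℝ}
    (hf : ∀ i, Integrable (f i) P) {m : MeasurableSpace Ω} {M : ι → MeasurableSpace Ω}
    (hm : ∀ i ∈ s, m ≤ M i) (hM : ∀ i, M i ≤ m0) :
    P[fun ω => ∑ i ∈ s, (P[f i | M i]) ω | m] =ᵐ[P] P[fun ω => ∑ i ∈ s, f i ω | m] := by
  have e1 : (fun ω => ∑ i ∈ s, (P[f i | M i]) ω) = ∑ i ∈ s, P[f i | M i] := by
    ext ω; simp
  have e2 : (fun ω => ∑ i ∈ s, f i ω) = ∑ i ∈ s, f i := by ext ω; simp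
  rw [e1, e2]
  refine (condExp_finsetSum (fun i _ => integrable_condExp) m).trans
    (Filter.EventuallyEq.trans ?_ (condExp_finsetSum (fun i _ => hf i) m).symm)
  have h : ∀ᵐ ω ∂P, ∀ i ∈ s, (P[P[f i | M i] | m]) ω = (P[f i | m]) ω := by
    rw [Finset.eventually_all]
    exact fun i hi => condExp_condExp_of_le (hm i hi) (hM i)
  filter_upwards [h] with ω hω
  simp only [Finset.sum_apply]
  exact Finset.sum_congr rfl hω

lemma sum_range_two_mul (f : ℕ → ℝ) (n : ℕ) :
    ∑ i ∈ Finset.range (2 * n), f i = ∑ i ∈ Finset.range n, (f (2 * i) + f (2 * i + 1)) := by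
  induction n with
  | zero => simp
  | succ n ih => rw [mul_add, mul_one, Finset.sum_range_succ, Finset.sum_range_succ, ih,
      Finset.sum_range_succ]; ring

/-- A predictable sequence whose conditional dyadic block sums are bounded by `a l` has a sum that
is subgaussian up to a bounded shift. -/
lemma exists_isSubGaussianOn_sum_predictable [IsFiniteMeasure P] (r : ℕ) :
    ∀ {G : ℕ → MeasurableSpace Ω}, Monotone G → (∀ j, G j ≤ m0) → ∀ {U : ℕ → Ω → ℝ},
    (∀ j, StronglyMeasurable[G j] (U j)) → (∀ j, Integrable (U j) P) →
    ∀ {a : ℕ → ℝ}, (∀ l, 0 < a l) →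
    (∀ l j, ∀ᵐ ω ∂P, |(P[fun ω => ∑ i ∈ Finset.range (2 ^ l), U (j + i) ω | G j]) ω| ≤ a l) →
    ∀ {E : Set Ω}, MeasurableSet[G 0] E →
    ∃ V : Ω → ℝ, (∀ᵐ ω ∂P, |V ω| ≤ a r) ∧
      IsSubGaussianOn P E (fun ω => ∑ j ∈ Finset.range (2 ^ r), U j ω - V ω)
        (∑ l ∈ Finset.range (r + 1), 2 * a l * √(2 ^ (r - l))) := by
  induction r with
  | zero =>
    intro G hG hle U hU hint a ha hbl E hE
    refine ⟨U 0, ?_, ?_⟩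
    · have := hbl 0 0
      simp only [pow_zero, Finset.range_one, Finset.sum_singleton, add_zero] at this
      rwa [condExp_of_stronglyMeasurable (hle 0) (hU 0) (hint 0)] at this
    · simpa using isSubGaussianOn_zero (P := P) E _
  | succ r ih =>
    intro G hG hle U hU hint a ha hbl E hE
    have hU1 : ∀ j, ∀ᵐ ω ∂P, |U j ω| ≤ a 0 := fun j => by
      have := hbl 0 j
      simp only [pow_zero, Finset.range_one, Finset.sum_singleton, add_zero] at this
      rwa [condExp_of_stronglyMeasurable (hle j) (hU j) (hint j)] at this
    have hint2 : ∀ b, Integrable (fun ω => U (2 * b) ω + U (2 * b + 1) ω) P :=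
      fun b => (hint _).add (hint _)
    -- U (2b) is known at stage 2b, so the pair sums to D b + U' b: a martingale difference bounded
    -- by 2 a 0, and a predictable remainder.
    set D : ℕ → Ω → ℝ := fun b ω => U (2 * b + 1) ω - (P[U (2 * b + 1) | G (2 * b)]) ω with hD
    set U' : ℕ → Ω → ℝ := fun b => P[fun ω => U (2 * b) ω + U (2 * b + 1) ω | G (2 * b)] with hU'
    have hG' : Monotone fun b => G (2 * b) := fun i j hij => hG (by omega)
    -- By the tower property, a block of 2^l remainders has the conditional mean of a block of
    -- 2^(l+1) original terms, so the bounds shift from a l to a (l + 1).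
    obtain ⟨V, hV1, hV2⟩ := ih (G := fun b => G (2 * b)) hG' (fun b => hle _) (U := U')
      (fun b => stronglyMeasurable_condExp) (fun b => integrable_condExp)
      (a := fun l => a (l + 1)) (fun l => ha _) (fun l j => by
        have h1 := condExp_sum_condExp (P := P) (Finset.range (2 ^ l))
          (f := fun i ω => U (2 * (j + i)) ω + U (2 * (j + i) + 1) ω) (fun i => hint2 (j + i))
          (m := G (2 * j)) (M := fun i => G (2 * (j + i))) (fun i _ => hG (by omega))
          (fun i => hle _)
        have h2 := hbl (l + 1) (2 * j)
        have h3 : (fun ω => ∑ i ∈ Finset.range (2 ^ (l + 1)), U (2 * j + i) ω) =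
            fun ω => ∑ i ∈ Finset.range (2 ^ l),
              (U (2 * (j + i)) ω + U (2 * (j + i) + 1) ω) := by
          ext ω
          rw [pow_succ', sum_range_two_mul (fun i => U (2 * j + i) ω)]
          simp only [mul_add, add_assoc]
        rw [h3] at h2
        filter_upwards [h1, h2] with ω h1 h2
        rw [← h1] at h2
        exact h2) (E := E) hE
    refine ⟨V, hV1, ?_⟩
    have hDsub : IsSubGaussianOn P E (fun ω => ∑ b ∈ Finset.range (2 ^ r), D b ω)
        (√((2 ^ r : ℕ) : ℝ) * (2 * a 0)) := by
      refine isSubGaussianOn_martingaleDiff (G := fun b => G (2 * b)) hG' (fun b => hle _)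
        (by have := ha 0; positivity) (fun b => ?_) (fun b => ?_) (fun b => ?_) hE _
      · exact ((hU _).mono (hG (by omega))).sub
          (stronglyMeasurable_condExp.mono (hG (by omega)))
      · have := ae_bdd_abs_condExp_of_ae_bdd_abs (m := G (2 * b)) (R := a 0)
          (hU1 (2 * b + 1))
        filter_upwards [hU1 (2 * b + 1), this] with ω h1 h2
        have h2' : |(P[U (2 * b + 1) | G (2 * b)]) ω| ≤ a 0 := h2
        simp only [hD]
        refine (abs_sub _ _).trans (by linarith)
      · have h1 := condExp_sub (m := G (2 * b)) (hint (2 * b + 1))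
          (integrable_condExp (μ := P) (m := G (2 * b)) (f := U (2 * b + 1)))
        have h2 := condExp_condExp_of_le (μ := P) (f := U (2 * b + 1)) (le_refl (G (2 * b)))
          (hle _)
        have h0 : D b = U (2 * b + 1) - P[U (2 * b + 1) | G (2 * b)] := rfl
        filter_upwards [h1, h2] with ω h1 h2
        rw [h0, h1, Pi.sub_apply, h2]
        simp
    -- There are only 2^r differences; the looser √(2^(r+1)) is the l = 0 term of the claimed sum.
    have hsum := (hDsub.mono (τ := 2 * a 0 * √(2 ^ (r + 1)))
      (by have := ha 0; positivity) (by
        rw [mul_comm, Nat.cast_pow, Nat.cast_two]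
        have := ha 0
        have h2 : (2 : ℝ) ^ r ≤ 2 ^ (r + 1) := pow_le_pow_right₀ (by norm_num) (by omega)
        gcongr)).add hV2 (by have := ha 0; positivity)
      (Finset.sum_pos (fun l _ => by have := ha (l + 1); positivity) ⟨0, by simp⟩)
    have hσ : ∑ l ∈ Finset.range (r + 1 + 1), 2 * a l * √(2 ^ (r + 1 - l)) =
        2 * a 0 * √(2 ^ (r + 1)) +
          ∑ l ∈ Finset.range (r + 1), 2 * a (l + 1) * √(2 ^ (r - l)) := by
      rw [Finset.sum_range_succ', add_comm]
      simp
    rw [hσ]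
    refine hsum.congr ?_
    have hall : ∀ᵐ ω ∂P, ∀ b, U' b ω = U (2 * b) ω + (P[U (2 * b + 1) | G (2 * b)]) ω := by
      rw [ae_all_iff]
      intro b
      have h1 := condExp_add (hint (2 * b)) (hint (2 * b + 1)) (G (2 * b))
      rw [condExp_of_stronglyMeasurable (hle _) (hU (2 * b)) (hint _)] at h1
      exact h1
    filter_upwards [hall] with ω hω
    rw [pow_succ', sum_range_two_mul (fun i => U i ω)]
    simp only [hD, hω, ← add_sub_assoc, ← Finset.sum_add_distrib]
    congr 1
    refine Finset.sum_congr rfl fun b _ => ?_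
    ring

/-- An adapted sequence with conditional means bounded by `ρ` has a sum that is subgaussian up to a
bounded shift. -/
lemma exists_isSubGaussianOn_sum_adapted [IsFiniteMeasure P] (r : ℕ)
    {G : ℕ → MeasurableSpace Ω} (hG : Monotone G) (hle : ∀ j, G j ≤ m0) {Y : ℕ → Ω → ℝ}
    (hY : ∀ j, StronglyMeasurable[G (j + 1)] (Y j)) (hY1 : ∀ j ω, |Y j ω| ≤ 1)
    {ρ : ℕ → ℝ} (hρ0 : 0 < ρ 0) (hρ : ∀ i, 0 ≤ ρ i)
    (hmix : ∀ j i, ∀ᵐ ω ∂P, |(P[Y (j + i) | G j]) ω| ≤ ρ i)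
    {E : Set Ω} (hE : MeasurableSet[G 0] E) :
    ∃ V : Ω → ℝ, (∀ᵐ ω ∂P, |V ω| ≤ ∑ i ∈ Finset.range (2 ^ r), ρ i) ∧
      IsSubGaussianOn P E (fun ω => ∑ j ∈ Finset.range (2 ^ r), Y j ω - V ω)
        (2 * √(2 ^ r) + ∑ l ∈ Finset.range (r + 1),
          2 * (∑ i ∈ Finset.range (2 ^ l), ρ i) * √(2 ^ (r - l))) := by
  have hint : ∀ j, Integrable (Y j) P := fun j =>
    Integrable.of_bound ((hY j).mono (hle _)).aestronglyMeasurable 1 (ae_of_all _ (hY1 j))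
  have ha : ∀ l : ℕ, 0 < ∑ i ∈ Finset.range (2 ^ l), ρ i := fun l =>
    Finset.sum_pos' (fun i _ => hρ i) ⟨0, by simp, hρ0⟩
  obtain ⟨V, hV1, hV2⟩ := exists_isSubGaussianOn_sum_predictable (P := P) r hG hle
    (U := fun j => P[Y j | G j]) (fun j => stronglyMeasurable_condExp)
    (fun j => integrable_condExp) (a := fun l => ∑ i ∈ Finset.range (2 ^ l), ρ i) ha
    (fun l j => by
      have h1 := condExp_sum_condExp (P := P) (Finset.range (2 ^ l)) (f := fun i => Y (j + i))
        (fun i => hint _) (m := G j) (M := fun i => G (j + i)) (fun i _ => hG (by omega))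
        (fun i => hle _)
      have e2 : (fun ω => ∑ i ∈ Finset.range (2 ^ l), Y (j + i) ω) =
          ∑ i ∈ Finset.range (2 ^ l), Y (j + i) := by ext ω; simp
      have h2 := condExp_finsetSum (μ := P) (s := Finset.range (2 ^ l))
        (f := fun i => Y (j + i)) (fun i _ => hint _) (G j)
      rw [e2] at h1
      filter_upwards [h1, h2, ae_all_iff.mpr (hmix j)] with ω h1 h2 h3
      rw [h1, h2, Finset.sum_apply]
      exact (Finset.abs_sum_le_sum_abs _ _).trans (Finset.sum_le_sum fun i _ => h3 i)) hE
  refine ⟨V, hV1, ?_⟩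
  -- The innovations are bounded by 2 and account for the extra term 2√(2^r).
  have hDsub : IsSubGaussianOn P E
      (fun ω => ∑ j ∈ Finset.range (2 ^ r), (Y j ω - (P[Y j | G j]) ω))
      (√((2 ^ r : ℕ) : ℝ) * 2) := by
    refine isSubGaussianOn_martingaleDiff hG hle (by norm_num) (fun j => ?_) (fun j => ?_)
      (fun j => ?_) hE _
    · exact (hY j).sub (stronglyMeasurable_condExp.mono (hG (by omega)))
    · have := ae_bdd_abs_condExp_of_ae_bdd_abs (μ := P) (m := G j) (R := 1) (ae_of_all _ (hY1 j))
      filter_upwards [this] with ω h2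
      have h2' : |(P[Y j | G j]) ω| ≤ 1 := h2
      refine (abs_sub _ _).trans (by linarith [hY1 j ω])
    · have h1 := condExp_sub (m := G j) (hint j)
        (integrable_condExp (μ := P) (m := G j) (f := Y j))
      have h2 := condExp_condExp_of_le (μ := P) (f := Y j) (le_refl (G j)) (hle _)
      have h0 : (fun ω => Y j ω - (P[Y j | G j]) ω) = Y j - P[Y j | G j] := rfl
      filter_upwards [h1, h2] with ω h1 h2
      rw [h0, h1, Pi.sub_apply, h2]
      simp
  have := hDsub.add hV2 (by positivity)
    (Finset.sum_pos (fun l _ => by have := ha l; positivity) ⟨0, by simp⟩)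
  have e : √((2 ^ r : ℕ) : ℝ) * 2 = 2 * √(2 ^ r) := by push_cast; ring
  rw [e] at this
  refine this.congr (ae_of_all _ fun ω => ?_)
  simp only [Finset.sum_sub_distrib]
  ring

end Dyadic

/-! ### Admissible constants and the dependence factor. -/

section Constants

lemma sum_Icc_one_eq (f : ℕ → ℝ) (n : ℕ) :
    ∑ k ∈ Finset.Icc 1 n, f k = ∑ i ∈ Finset.range n, f (i + 1) := by
  induction n with
  | zero => simp
  | succ n ih => rw [Finset.sum_Icc_succ_top (by omega), Finset.sum_range_succ, ih]

lemma rpow_neg_three_halves {x : ℝ} (hx : 0 < x) : x ^ (-(3 / 2) : ℝ) = (x * √x)⁻¹ := by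
  rw [Real.rpow_neg hx.le, Real.sqrt_eq_rpow, show (3 / 2 : ℝ) = 1 + 1 / 2 by norm_num,
    Real.rpow_add hx, Real.rpow_one]

/-- A telescoping majorant of j^(-3/2), made for summation by parts. -/
lemma rpow_neg_three_halves_le (n : ℕ) :
    ((n + 1 : ℕ) : ℝ) ^ (-(3 / 2) : ℝ) ≤
      4 / √((n + 1 : ℕ) : ℝ) - 4 / √((n + 2 : ℕ) : ℝ) := by
  rw [rpow_neg_three_halves (by positivity)]
  set u := √((n + 1 : ℕ) : ℝ) with hu
  set v := √((n + 2 : ℕ) : ℝ) with hv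
  have hu0 : 0 < u := Real.sqrt_pos.mpr (by positivity)
  have hv0 : 0 < v := Real.sqrt_pos.mpr (by positivity)
  have hu2 : u ^ 2 = n + 1 := by rw [hu, Real.sq_sqrt (by positivity)]; push_cast; ring
  have hv2 : v ^ 2 = n + 2 := by rw [hv, Real.sq_sqrt (by positivity)]; push_cast; ring
  have hn : (0 : ℝ) ≤ n := Nat.cast_nonneg n
  have hvu : v ≤ 3 / 2 * u := by
    refine le_of_sq_le_sq ?_ (by positivity)
    nlinarith
  have e : ((n + 1 : ℕ) : ℝ) * u = u ^ 3 := by push_cast; rw [← hu2]; ring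
  rw [e, div_sub_div _ _ hu0.ne' hv0.ne', inv_eq_one_div, div_le_div_iff₀ (by positivity)
    (by positivity)]
  have h1 : (v - u) * (v + u) = 1 := by nlinarith
  have h2 : 0 < v - u := by
    by_contra h
    nlinarith
  have h3 : 1 ≤ (v - u) * (5 / 2 * u) := by nlinarith
  have h4 : v * u ≤ 3 / 2 * u ^ 2 := by nlinarith
  have h5 : u ^ 2 ≤ (v - u) * (5 / 2 * u) * u ^ 2 := le_mul_of_one_le_left (by positivity) h3
  nlinarith

/-- Summation by parts against the telescoping majorant. The induction closes because `key` keeps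
the boundary term 4/√(n+1) ∑_{k≤n} k^(-α), which is nonnegative and dropped at the end. -/
lemma isDependenceConstant_four (α : ℝ) : IsDependenceConstant α 4 := by
  intro n
  have key : ∀ n : ℕ, ∑ j ∈ Finset.Icc 1 n,
      (j : ℝ) ^ (-(3 / 2) : ℝ) * ∑ k ∈ Finset.Icc 1 j, (k : ℝ) ^ (-α)
      + 4 / √((n + 1 : ℕ) : ℝ) * ∑ k ∈ Finset.Icc 1 n, (k : ℝ) ^ (-α)
      ≤ 4 * ∑ j ∈ Finset.Icc 1 n, (j : ℝ) ^ (-(1 / 2) - α : ℝ) := by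
    intro n
    induction n with
    | zero => simp
    | succ n ih =>
      have hs : ∑ k ∈ Finset.Icc 1 (n + 1), (k : ℝ) ^ (-α) =
          ∑ k ∈ Finset.Icc 1 n, (k : ℝ) ^ (-α) + ((n + 1 : ℕ) : ℝ) ^ (-α) :=
        Finset.sum_Icc_succ_top (by omega) _
      rw [Finset.sum_Icc_succ_top (by omega), Finset.sum_Icc_succ_top (b := n) (by omega)
        (fun j : ℕ => (j : ℝ) ^ (-(1 / 2) - α : ℝ))]
      have h0 : 0 ≤ ∑ k ∈ Finset.Icc 1 (n + 1), (k : ℝ) ^ (-α) :=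
        Finset.sum_nonneg fun k _ => by positivity
      have h1 := mul_le_mul_of_nonneg_right (rpow_neg_three_halves_le n) h0
      have h2 : ((n + 1 : ℕ) : ℝ) ^ (-(1 / 2) - α : ℝ) =
          1 / √((n + 1 : ℕ) : ℝ) * ((n + 1 : ℕ) : ℝ) ^ (-α) := by
        rw [sub_eq_add_neg, Real.rpow_add (by positivity), Real.rpow_neg (by positivity),
          ← Real.sqrt_eq_rpow, one_div]
      rw [h2]
      have h3 : 4 / √((n + 1 : ℕ) : ℝ) * ∑ k ∈ Finset.Icc 1 (n + 1), (k : ℝ) ^ (-α) =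
          4 / √((n + 1 : ℕ) : ℝ) * ∑ k ∈ Finset.Icc 1 n, (k : ℝ) ^ (-α)
          + 4 * (1 / √((n + 1 : ℕ) : ℝ) * ((n + 1 : ℕ) : ℝ) ^ (-α)) := by
        rw [hs]; ring
      have h4 : 4 / √((n + 1 + 1 : ℕ) : ℝ) = 4 / √((n + 2 : ℕ) : ℝ) := rfl
      rw [h4]
      linarith [ih, h1, h3]
  refine le_trans (le_add_of_nonneg_right ?_) (key n)
  exact mul_nonneg (by positivity) (Finset.sum_nonneg fun k _ => by positivity)

lemma one_le_of_isDependenceConstant {α c : ℝ} (hc : IsDependenceConstant α c) : 1 ≤ c := by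
  simpa using hc 1

lemma summable_weights {α : ℝ} (hα : 1 / 2 < α) :
    Summable fun j : ℕ => ((j + 1 : ℕ) : ℝ) ^ (-(1 / 2) - α : ℝ) := by
  have h : Summable fun n : ℕ => (n : ℝ) ^ (-(1 / 2) - α : ℝ) :=
    Real.summable_nat_rpow.mpr (by linarith)
  exact (summable_nat_add_iff 1).mpr h

lemma one_le_tsum_weights {α : ℝ} (hα : 1 / 2 < α) :
    1 ≤ ∑' j : ℕ, ((j + 1 : ℕ) : ℝ) ^ (-(1 / 2) - α : ℝ) := by
  have := (summable_weights hα).le_tsum 0 (fun j _ => by positivity)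
  simpa using this

lemma eighty_le_depFactor {α c : ℝ} (hα : 1 / 2 < α) (hc : IsDependenceConstant α c) :
    80 ≤ depFactor α c := by
  have h1 := one_le_of_isDependenceConstant hc
  have h2 := one_le_tsum_weights hα
  unfold depFactor
  nlinarith

lemma sum_le_depFactor {α c : ℝ} (hα : 1 / 2 < α) (hc : IsDependenceConstant α c) (n : ℕ) :
    ∑ j ∈ Finset.Icc 1 n, (j : ℝ) ^ (-(3 / 2) : ℝ) * ∑ k ∈ Finset.Icc 1 j, (k : ℝ) ^ (-α)
      ≤ depFactor α c / 80 := by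
  refine (hc n).trans ?_
  have h1 := one_le_of_isDependenceConstant hc
  have h2 : ∑ j ∈ Finset.Icc 1 n, (j : ℝ) ^ (-(1 / 2) - α : ℝ) ≤
      ∑' j : ℕ, ((j + 1 : ℕ) : ℝ) ^ (-(1 / 2) - α : ℝ) := by
    rw [sum_Icc_one_eq]
    exact (summable_weights hα).sum_le_tsum _ (fun j _ => by positivity)
  unfold depFactor
  nlinarith

/-- The inner sums increase with j, so the 2^l indices in [2^l, 2^(l+1)) contribute at least
a(2^l)/(2√2 √(2^l)) to the admissibility sum; 3 bounds 2√2. -/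
lemma sum_dyadic_le {α c : ℝ} (hα : 1 / 2 < α) (hc : IsDependenceConstant α c) (r : ℕ) :
    ∑ l ∈ Finset.range r, (∑ i ∈ Finset.range (2 ^ l), ((i + 1 : ℕ) : ℝ) ^ (-α)) / √(2 ^ l)
      ≤ 3 * (depFactor α c / 80) := by
  set a : ℕ → ℝ := fun j => ∑ k ∈ Finset.Icc 1 j, (k : ℝ) ^ (-α) with ha
  have ha0 : ∀ j, 0 ≤ a j := fun j => Finset.sum_nonneg fun k _ => by positivity
  have hmono : Monotone a := fun i j hij =>
    Finset.sum_le_sum_of_subset_of_nonneg (Finset.Icc_subset_Icc_right hij)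
      fun k _ _ => by positivity
  have key : ∀ r : ℕ, ∑ l ∈ Finset.range r, a (2 ^ l) / √(2 ^ l) ≤
      3 * ∑ j ∈ Finset.Ico (1 : ℕ) (2 ^ r), (j : ℝ) ^ (-(3 / 2) : ℝ) * a j := by
    intro r
    induction r with
    | zero => simp
    | succ r ih =>
      rw [Finset.sum_range_succ, ← Finset.sum_Ico_consecutive _ (Nat.one_le_two_pow (n := r))
        (Nat.pow_le_pow_right (by norm_num) (Nat.le_succ r)), mul_add]
      refine add_le_add ih ?_
      set x : ℝ := 2 ^ r with hx
      have hx0 : 0 < x := by positivity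
      have hs : 0 < √x := Real.sqrt_pos.mpr hx0
      have h := Finset.card_nsmul_le_sum (Finset.Ico (2 ^ r) (2 ^ (r + 1)))
        (fun j : ℕ => (j : ℝ) ^ (-(3 / 2) : ℝ) * a j) ((2 * x) ^ (-(3 / 2) : ℝ) * a (2 ^ r))
        (fun j hj => by
          obtain ⟨h1, h2⟩ := Finset.mem_Ico.mp hj
          have hj0 : (0 : ℝ) < j := by
            have : 0 < 2 ^ r := by positivity
            exact_mod_cast this.trans_le h1
          have hj2 : (j : ℝ) ≤ 2 * x := by
            rw [hx, ← pow_succ']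
            exact_mod_cast h2.le
          have h3 : (2 * x) ^ (-(3 / 2) : ℝ) ≤ (j : ℝ) ^ (-(3 / 2) : ℝ) :=
            Real.rpow_le_rpow_of_nonpos hj0 hj2 (by norm_num)
          exact mul_le_mul h3 (hmono h1) (ha0 _) (by positivity))
      have hcard : (Finset.Ico (2 ^ r) (2 ^ (r + 1))).card = 2 ^ r := by
        rw [Nat.card_Ico, pow_succ]; omega
      rw [hcard, nsmul_eq_mul, Nat.cast_pow, Nat.cast_two, ← hx,
        rpow_neg_three_halves (by positivity)] at h
      refine le_trans ?_ (mul_le_mul_of_nonneg_left h (by norm_num : (0 : ℝ) ≤ 3))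
      have h2 : √(2 * x) ≤ 3 / 2 * √x := by
        rw [Real.sqrt_mul (by norm_num)]
        have : √2 ≤ 3 / 2 := by
          rw [Real.sqrt_le_left (by norm_num)]; norm_num
        gcongr
      have h3 : (1 : ℝ) / √x ≤ 3 * (x * (2 * x * √(2 * x))⁻¹) := by
        rw [← div_eq_mul_inv, ← mul_div_assoc, div_le_div_iff₀ hs (by positivity)]
        nlinarith
      calc a (2 ^ r) / √x = 1 / √x * a (2 ^ r) := by ring
        _ ≤ 3 * (x * (2 * x * √(2 * x))⁻¹) * a (2 ^ r) :=
          mul_le_mul_of_nonneg_right h3 (ha0 _)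
        _ = _ := by ring
  have e : ∀ l : ℕ, ∑ i ∈ Finset.range (2 ^ l), ((i + 1 : ℕ) : ℝ) ^ (-α) = a (2 ^ l) := fun l =>
    (sum_Icc_one_eq (fun k => (k : ℝ) ^ (-α)) _).symm
  simp only [e]
  refine (key r).trans ?_
  have h1 : (Finset.Ico 1 (2 ^ r)) = Finset.Icc 1 (2 ^ r - 1) := by
    ext j
    have : 0 < 2 ^ r := by positivity
    simp only [Finset.mem_Ico, Finset.mem_Icc]
    omega
  rw [h1]
  gcongr
  exact sum_le_depFactor hα hc _

end Constants

/-! ### The deviation inequality. -/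

section Deviation

variable {Ω : Type*} {m0 : MeasurableSpace Ω} {P : Measure Ω}

lemma exists_two_pow_between {n : ℕ} (hn : 1 ≤ n) :
    ∃ r : ℕ, n ≤ 2 ^ r ∧ (2 : ℝ) ^ r ≤ 2 * n := by
  refine ⟨Nat.log 2 n + 1, (Nat.lt_pow_succ_log_self (by norm_num) n).le, ?_⟩
  rw [pow_succ']
  have : 2 ^ Nat.log 2 n ≤ n := Nat.pow_log_le_self 2 (by omega)
  have h : (2 : ℝ) ^ Nat.log 2 n ≤ n := by exact_mod_cast this
  linarith

/-- The deviation inequality for adapted sequences that mix at the rate `n ^ (-α)`. -/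
lemma measure_deviation_le [IsFiniteMeasure P] {α c : ℝ} (hα : 1 / 2 < α)
    (hc : IsDependenceConstant α c)
    {G : ℕ → MeasurableSpace Ω} (hG : Monotone G) (hle : ∀ j, G j ≤ m0) {Y : ℕ → Ω → ℝ}
    (hY : ∀ j, StronglyMeasurable[G (j + 1)] (Y j)) (hY1 : ∀ j ω, |Y j ω| ≤ 1)
    (hmix : ∀ j i, ∀ᵐ ω ∂P, |(P[Y (j + i) | G j]) ω| ≤ ((i + 1 : ℕ) : ℝ) ^ (-α))
    {E : Set Ω} (hE : MeasurableSet[G 0] E) {n : ℕ} (hn : 1 ≤ n) (hYn : ∀ j, n ≤ j → Y j = 0)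
    {L : ℝ} (hL : 1 / 2 ≤ L) :
    P.real (E ∩ {ω | n * ((1 + depFactor α c) * √(2 * L / n)) ≤
      |∑ j ∈ Finset.range n, Y j ω|}) ≤ 2 * Real.exp (-L) * P.real E := by
  obtain ⟨r, hn2, h2n⟩ := exists_two_pow_between hn
  obtain ⟨V, hV1, hV2⟩ := exists_isSubGaussianOn_sum_adapted (P := P) r hG hle hY hY1
    (ρ := fun i => ((i + 1 : ℕ) : ℝ) ^ (-α)) (by positivity) (fun i => by positivity) hmix hE
  set a : ℕ → ℝ := fun l => ∑ i ∈ Finset.range (2 ^ l), ((i + 1 : ℕ) : ℝ) ^ (-α) with ha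
  have ha0 : ∀ l, 0 ≤ a l := fun l => Finset.sum_nonneg fun k _ => by positivity
  -- Everything is measured in δ√n, where δ ≥ 1 absorbs plain multiples of √n. Of the 80 δ√n in the
  -- threshold, 5 pay for the shift V, and the remaining 75 are compared with σ ≤ 12 δ√n.
  set δ := depFactor α c / 80 with hδ
  have hδ1 : 1 ≤ δ := by
    have := eighty_le_depFactor hα hc
    rw [hδ]
    linarith
  have hM : depFactor α c = 80 * δ := by rw [hδ]; ring
  have hsum : ∑ l ∈ Finset.range (r + 1), a l / √(2 ^ l) ≤ 3 * δ := sum_dyadic_le hα hc (r + 1)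
  have hn0 : (0 : ℝ) < n := by exact_mod_cast hn
  set N := √(n : ℝ) with hN
  have hN0 : 0 < N := Real.sqrt_pos.mpr hn0
  have hr2 : √(2 ^ r) ≤ 3 / 2 * N := by
    have : (3 / 2 * N) = √(9 / 4 * n) := by
      rw [Real.sqrt_mul (by norm_num), show (9 / 4 : ℝ) = (3 / 2) ^ 2 by norm_num,
        Real.sqrt_sq (by norm_num)]
    rw [this]
    exact Real.sqrt_le_sqrt (by linarith)
  have har : a r ≤ 5 * δ * N := by
    have h1 : a r / √(2 ^ r) ≤ 3 * δ := le_trans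
      (Finset.single_le_sum (f := fun l => a l / √(2 ^ l))
        (fun l _ => div_nonneg (ha0 l) (Real.sqrt_nonneg _)) (by simp)) hsum
    rw [div_le_iff₀ (by positivity)] at h1
    nlinarith [mul_pos (lt_of_lt_of_le one_pos hδ1) hN0]
  set σ := 2 * √(2 ^ r) + ∑ l ∈ Finset.range (r + 1), 2 * a l * √(2 ^ (r - l)) with hσ
  have hσ0 : 0 < σ := by
    refine add_pos_of_pos_of_nonneg (by positivity) (Finset.sum_nonneg fun l _ => ?_)
    exact mul_nonneg (mul_nonneg zero_le_two (ha0 l)) (Real.sqrt_nonneg _)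
  have hσ1 : σ ≤ 12 * δ * N := by
    have e : ∑ l ∈ Finset.range (r + 1), 2 * a l * √(2 ^ (r - l)) =
        2 * √(2 ^ r) * ∑ l ∈ Finset.range (r + 1), a l / √(2 ^ l) := by
      rw [Finset.mul_sum]
      refine Finset.sum_congr rfl fun l hl => ?_
      have hl' : l ≤ r := by
        have := Finset.mem_range.mp hl
        omega
      have : (2 : ℝ) ^ r = 2 ^ (r - l) * 2 ^ l := by rw [← pow_add]; congr 1; omega
      have h0 : √((2 : ℝ) ^ l) ≠ 0 := by positivity
      rw [this, Real.sqrt_mul (by positivity)]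
      field_simp
    rw [hσ, e]
    have : √(2 ^ r) * ∑ l ∈ Finset.range (r + 1), a l / √(2 ^ l) ≤ 3 / 2 * N * (3 * δ) :=
      mul_le_mul hr2 hsum (Finset.sum_nonneg fun l _ =>
        div_nonneg (ha0 l) (Real.sqrt_nonneg _)) (by positivity)
    nlinarith
  set Q := √(2 * L) with hQ
  -- The shift does not grow with L; Q ≥ 1 lets the threshold absorb it.
  have hQ1 : 1 ≤ Q := by
    rw [hQ, Real.one_le_sqrt]
    linarith
  have hQ2 : Q ^ 2 = 2 * L := Real.sq_sqrt (by linarith)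
  have hx : (n : ℝ) * ((1 + depFactor α c) * √(2 * L / n)) = (1 + 80 * δ) * N * Q := by
    rw [Real.sqrt_div (by linarith), hM, ← hN, ← hQ]
    have : (n : ℝ) = N * N := (Real.mul_self_sqrt hn0.le).symm
    rw [this]
    field_simp
  have hNδ : 0 < δ * N := by positivity
  have hy : 75 * δ * N * Q ≤ (1 + 80 * δ) * N * Q - a r := by
    nlinarith [mul_le_mul_of_nonneg_left hQ1 hNδ.le, mul_pos hN0 (lt_of_lt_of_le one_pos hQ1)]
  set y := 75 * δ * N * Q with hydef
  have hy0 : 0 ≤ y := by positivity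
  have hexp : Real.exp (-(y ^ 2 / (2 * σ ^ 2))) ≤ Real.exp (-L) := by
    refine Real.exp_le_exp.mpr (neg_le_neg ?_)
    rw [le_div_iff₀ (mul_pos two_pos (pow_pos hσ0 2))]
    have h1 : σ ^ 2 ≤ (12 * δ * N) ^ 2 := pow_le_pow_left₀ hσ0.le hσ1 2
    have h2 : y ^ 2 = 5625 * (δ * N) ^ 2 * (2 * L) := by rw [hydef, ← hQ2]; ring
    rw [h2]
    have h3 : L * (2 * σ ^ 2) ≤ L * (2 * (12 * δ * N) ^ 2) :=
      mul_le_mul_of_nonneg_left (by linarith) (by linarith)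
    nlinarith [mul_nonneg (sq_nonneg (δ * N)) (by linarith : (0 : ℝ) ≤ L)]
  set S : Ω → ℝ := fun ω => ∑ j ∈ Finset.range (2 ^ r), Y j ω - V ω with hS
  -- The sequence vanishes from n on, so n may be rounded up to a power of two.
  have hsumY : ∀ ω, ∑ j ∈ Finset.range (2 ^ r), Y j ω = ∑ j ∈ Finset.range n, Y j ω := by
    intro ω
    refine (Finset.sum_subset (Finset.range_mono hn2) fun j _ hj => ?_).symm
    rw [hYn j (by simpa using hj)]
    rfl
  have hp := hV2.measure_ge_le hσ0 hy0
  have hm := hV2.neg.measure_ge_le hσ0 hy0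
  have hsub : P.real (E ∩ {ω | n * ((1 + depFactor α c) * √(2 * L / n)) ≤
      |∑ j ∈ Finset.range n, Y j ω|}) ≤
      P.real ((E ∩ {ω | y ≤ S ω}) ∪ (E ∩ {ω | y ≤ - S ω})) := by
    refine ENNReal.toReal_mono (measure_ne_top _ _) (measure_mono_ae ?_)
    filter_upwards [hV1] with ω hω hmem
    obtain ⟨hωE, hω2⟩ := hmem
    have hω2' : n * ((1 + depFactor α c) * √(2 * L / n)) ≤ |∑ j ∈ Finset.range n, Y j ω| := hω2
    rw [hx, ← hsumY] at hω2'
    have h1 : |∑ j ∈ Finset.range (2 ^ r), Y j ω| ≤ |S ω| + |V ω| := by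
      have := abs_add_le (S ω) (V ω)
      simpa [hS] using this
    have h2 : y ≤ |S ω| := by linarith
    rcases le_abs.mp h2 with h | h
    · exact Or.inl ⟨hωE, h⟩
    · exact Or.inr ⟨hωE, h⟩
  refine hsub.trans ((measureReal_union_le _ _).trans ?_)
  have h0 : 0 ≤ P.real E := measureReal_nonneg
  have := mul_le_mul_of_nonneg_right hexp h0
  linarith

end Deviation

/-- Lists the pull positions of an arm in time order. The list continues past the end of Q so that
it can index a filtration over all of ℕ. -/
lemma exists_strictMono_enumeration (Q : Finset ℕ) :
    ∃ q : ℕ → ℕ, StrictMono q ∧ (∀ j < Q.card, q j ∈ Q) ∧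
      ∀ f : ℕ → ℝ, ∑ p ∈ Q, f p = ∑ j ∈ Finset.range Q.card, f (q j) := by
  induction Q using Finset.induction_on_max with
  | empty => exact ⟨id, strictMono_id, by simp, by simp⟩
  | insert a s hs ih =>
    obtain ⟨q, hq1, hq2, hq3⟩ := ih
    have ha : a ∉ s := fun h => (hs a h).false
    rw [Finset.card_insert_of_notMem ha]
    refine ⟨fun j => if j < s.card then q j else a + (j - s.card), ?_, ?_, ?_⟩
    · refine strictMono_nat_of_lt_succ fun j => ?_
      by_cases h1 : j + 1 < s.card
      · simp only [h1, show j < s.card by omega, if_true]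
        exact hq1 (Nat.lt_succ_self j)
      · by_cases h2 : j < s.card
        · simp only [h1, h2, if_true, if_false]
          exact (hs _ (hq2 j h2)).trans_le (by omega)
        · simp only [h1, h2, if_false]
          omega
    · intro j hj
      by_cases h2 : j < s.card
      · simp only [h2, if_true]
        exact Finset.mem_insert_of_mem (hq2 j h2)
      · simp [show j = s.card by omega]
    · intro f
      rw [Finset.sum_insert ha, Finset.sum_range_succ, hq3, add_comm]
      congr 1
      · refine Finset.sum_congr rfl fun j hj => ?_
        simp [Finset.mem_range.mp hj]
      · simp

/-! ### Concentration of the rewards of one arm. -/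

section History

variable {Ω : Type*} {K : ℕ} {X : Fin K → ℕ → Ω → unitInterval}

lemma history_mono : Monotone (history X) := fun i j hij =>
  iSup_mono fun _ => biSup_mono fun l hl => by
    simp only [Finset.mem_Icc] at hl ⊢
    omega

lemma history_zero : history X 0 = ⊥ := by simp [history]

lemma measurable_history {k : Fin K} {j i : ℕ} (h1 : 1 ≤ j) (h2 : j ≤ i) :
    Measurable[history X i] (X k j) := by
  have h : MeasurableSpace.comap (X k j) inferInstance ≤ history X i :=
    le_iSup_of_le k (le_iSup₂_of_le j (Finset.mem_Icc.mpr ⟨h1, h2⟩) le_rfl)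
  exact (comap_measurable (X k j)).mono h le_rfl

lemma measurable_history_coe {k : Fin K} {j i : ℕ} (h1 : 1 ≤ j) (h2 : j ≤ i) :
    Measurable[history X i] (fun ω => (X k j ω : ℝ)) :=
  measurable_subtype_coe.comp (measurable_history h1 h2)

variable [m0 : MeasurableSpace Ω] {P : Measure Ω}

lemma history_le (hX : ∀ k t, Measurable (X k t)) (i : ℕ) : history X i ≤ m0 :=
  iSup_le fun k => iSup₂_le fun j _ => (hX k j).comap_le

lemma integrable_arm [IsFiniteMeasure P] (hX : ∀ k t, Measurable (X k t)) (k : Fin K) (t : ℕ) :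
    Integrable (fun ω => (X k t ω : ℝ)) P :=
  Integrable.of_bound (measurable_subtype_coe.comp (hX k t)).aestronglyMeasurable 1
    (ae_of_all _ fun ω => by
      rw [Real.norm_of_nonneg (X k t ω).2.1]
      exact (X k t ω).2.2)

lemma armMean_mem_Icc [IsProbabilityMeasure P] (hX : ∀ k t, Measurable (X k t)) (k : Fin K) :
    armMean P X k ∈ Set.Icc (0 : ℝ) 1 := by
  refine ⟨integral_nonneg fun ω => (X k 1 ω).2.1, ?_⟩
  have := integral_mono (integrable_arm (P := P) hX k 1) (integrable_const (1 : ℝ))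
    (fun ω => (X k 1 ω).2.2)
  simpa [armMean] using this

lemma condExp_sub_armMean_le [IsProbabilityMeasure P] {C : TestClass} {T : ℕ} {α : ℝ}
    (hC : (fun y : unitInterval => (y : ℝ)) ∈ C.unitBall) (hX : ∀ k t, Measurable (X k t))
    (hW : WeaklyStationary P X T) (hmix : MixesAtRate P C X T α)
    (k : Fin K) {i n : ℕ} (hn : 1 ≤ n) (hin : i + n ≤ T) :
    ∀ᵐ ω ∂P, |(P[fun ω => (X k (i + n) ω : ℝ) - armMean P X k | history X i]) ω|
      ≤ (n : ℝ) ^ (-α) := by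
  have hmean : ∫ ω, (X k (i + n) ω : ℝ) ∂P = armMean P X k :=
    (hW k).1 (i + n) (Finset.mem_Icc.mpr ⟨by omega, hin⟩) 1 (Finset.mem_Icc.mpr ⟨le_rfl, by omega⟩)
  have hint := integrable_arm (P := P) hX k (i + n)
  -- The mixing coefficients cover only i ≥ 1; at i = 0 the history is trivial and the conditional
  -- mean is the centred mean, zero.
  rcases Nat.eq_zero_or_pos i with rfl | hi
  · rw [history_zero, condExp_bot, integral_sub hint (integrable_const _), hmean]
    refine ae_of_all _ fun ω => ?_
    simp
    positivity
  · have h1 := hmix k n hn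
    have h2 : eLpNorm (fun ω => (P[fun ω' => (X k (i + n) ω' : ℝ) | history X i]) ω
        - ∫ ω', (X k (i + n) ω' : ℝ) ∂P) ∞ P ≤ ENNReal.ofReal ((n : ℝ) ^ (-α)) := by
      refine le_trans ?_ h1
      unfold mixingCoeff
      refine le_iSup₂_of_le _ hC ?_
      exact le_iSup₂_of_le i ⟨hi, hin⟩ le_rfl
    rw [hmean] at h2
    have h3 : P[fun ω => (X k (i + n) ω : ℝ) - armMean P X k | history X i] =ᵐ[P]
        fun ω => (P[fun ω => (X k (i + n) ω : ℝ) | history X i]) ω - armMean P X k := by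
      have := condExp_sub (m := history X i) hint (integrable_const (μ := P) (armMean P X k))
      rw [condExp_const (history_le hX i)] at this
      exact this
    rw [eLpNorm_exponent_top] at h2
    filter_upwards [ae_le_eLpNormEssSup (f := fun ω =>
      (P[fun ω' => (X k (i + n) ω' : ℝ) | history X i]) ω - armMean P X k) (μ := P), h3]
      with ω h4 h5
    rw [h5]
    have h6 := h4.trans h2
    rw [← ofReal_norm, ENNReal.ofReal_le_ofReal_iff (by positivity)] at h6
    exact h6

/-- Concentration of the average of the rewards of an arm over a fixed set of future times. -/
lemma measure_average_deviation_le [IsProbabilityMeasure P] {C : TestClass} {T : ℕ} {α c : ℝ}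
    (hα : 1 / 2 < α) (hc : IsDependenceConstant α c)
    (hC : (fun y : unitInterval => (y : ℝ)) ∈ C.unitBall) (hX : ∀ k t, Measurable (X k t))
    (hW : WeaklyStationary P X T) (hmix : MixesAtRate P C X T α)
    (k : Fin K) {t : ℕ} (ht : 1 ≤ t) {Q : Finset ℕ} (hQ : ∀ p ∈ Q, t + p ≤ T)
    (hn : 1 ≤ Q.card) {E : Set Ω} (hE : MeasurableSet[history X (t - 1)] E)
    {L : ℝ} (hL : 1 / 2 ≤ L) :
    P.real (E ∩ {ω | (1 + depFactor α c) * √(2 * L / Q.card) ≤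
      |(∑ p ∈ Q, (X k (t + p) ω : ℝ)) / Q.card - armMean P X k|})
      ≤ 2 * Real.exp (-L) * P.real E := by
  obtain ⟨q, hq1, hq2, hq3⟩ := exists_strictMono_enumeration Q
  set n := Q.card with hncard
  have hn0 : (0 : ℝ) < n := by exact_mod_cast hn
  have hμ := armMean_mem_Icc (P := P) hX k
  set Y : ℕ → Ω → ℝ := fun j ω => if j < n then (X k (t + q j) ω : ℝ) - armMean P X k else 0
    with hYdef
  have hYlt : ∀ j, j < n → Y j = fun ω => (X k (t + q j) ω : ℝ) - armMean P X k := by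
    intro j hj
    ext ω
    simp [hYdef, hj]
  have hYge : ∀ j, n ≤ j → Y j = 0 := by
    intro j hj
    ext ω
    simp [hYdef, hj]
  have hGmono : Monotone fun j => history X (t + q j - 1) := fun i j hij => by
    have := hq1.monotone hij
    exact history_mono (by omega)
  have hqadd : ∀ i j, q j + i ≤ q (j + i) := by
    intro i j
    induction i with
    | zero => simp
    | succ i ih =>
      have := hq1 (Nat.lt_succ_self (j + i))
      simp only [Nat.succ_eq_add_one] at this
      rw [← add_assoc j]
      omega
  -- Stage j is the history just before pull j. Pull j + i comes at least i + 1 steps after it, so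
  -- gaps spent on other arms only improve the mixing bound.
  have hmain := measure_deviation_le (P := P) hα hc (G := fun j => history X (t + q j - 1))
    hGmono (fun j => history_le hX _) (Y := Y) (fun j => by
      rcases lt_or_ge j n with h | h
      · rw [hYlt j h]
        refine Measurable.stronglyMeasurable ?_
        have := hq1 (Nat.lt_succ_self j)
        simp only [Nat.succ_eq_add_one] at this
        exact (measurable_history_coe (by omega) (by omega)).sub measurable_const
      · rw [hYge j h]
        exact stronglyMeasurable_zero) (fun j ω => by
      rcases lt_or_ge j n with h | h
      · rw [hYlt j h, abs_le]
        have h1 := (X k (t + q j) ω).2.1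
        have h2 := (X k (t + q j) ω).2.2
        constructor <;> linarith [hμ.1, hμ.2]
      · rw [hYge j h]
        simp) (fun j i => by
      rcases lt_or_ge (j + i) n with h | h
      · rw [hYlt _ h]
        have h1 := hqadd i j
        have h2 := condExp_sub_armMean_le (P := P) hC hX hW hmix k (i := t + q j - 1)
          (n := t + q (j + i) - (t + q j - 1)) (by omega) (by
            have := hQ _ (hq2 _ h)
            omega)
        rw [show t + q j - 1 + (t + q (j + i) - (t + q j - 1)) = t + q (j + i) by omega] at h2
        filter_upwards [h2] with ω h3
        refine h3.trans (Real.rpow_le_rpow_of_nonpos (by positivity) ?_ (by linarith))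
        exact_mod_cast (by omega : i + 1 ≤ t + q (j + i) - (t + q j - 1))
      · rw [hYge _ h, condExp_zero]
        refine ae_of_all _ fun ω => ?_
        simp only [Pi.zero_apply, abs_zero]
        positivity) (E := E) (history_mono (by omega) E hE) hn hYge hL
  refine le_trans (ENNReal.toReal_mono (measure_ne_top _ _) (measure_mono ?_)) hmain
  refine Set.inter_subset_inter_right _ fun ω hω => ?_
  have hω' : (1 + depFactor α c) * √(2 * L / n) ≤
      |(∑ p ∈ Q, (X k (t + p) ω : ℝ)) / n - armMean P X k| := hω
  have e : ∑ j ∈ Finset.range n, Y j ω =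
      n * ((∑ p ∈ Q, (X k (t + p) ω : ℝ)) / n - armMean P X k) := by
    rw [hq3 (fun p => (X k (t + p) ω : ℝ)), mul_sub, mul_div_cancel₀ _ hn0.ne']
    have : ∀ j ∈ Finset.range n, Y j ω = (X k (t + q j) ω : ℝ) - armMean P X k := fun j hj => by
      rw [hYlt j (Finset.mem_range.mp hj)]
    rw [Finset.sum_congr rfl this, Finset.sum_sub_distrib]
    simp
  change n * ((1 + depFactor α c) * √(2 * L / n)) ≤ |∑ j ∈ Finset.range n, Y j ω|
  rw [e, abs_mul, abs_of_pos hn0]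
  gcongr

end History

/-! ### Epoch lengths and confidence radii. -/

section Schedule

lemma theta_pos (s : ℕ) : 0 < theta s := by unfold theta; positivity

lemma theta_sq (s : ℕ) : theta s ^ 2 = (1 / 4) ^ s := by
  unfold theta
  rw [← pow_mul, mul_comm, pow_mul]
  norm_num

lemma theta_succ (s : ℕ) : theta (s + 1) = theta s / 2 := by
  unfold theta
  rw [pow_succ]
  ring

lemma theta_le_one (s : ℕ) : theta s ≤ 1 := by
  unfold theta
  exact pow_le_one₀ (by norm_num) (by norm_num)

lemma six_le_four_sqrt_exp : 6 ≤ 4 * √(Real.exp 1) := by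
  have : (3 / 2 : ℝ) ≤ √(Real.exp 1) := by
    refine Real.le_sqrt_of_sq_le ?_
    have := Real.exp_one_gt_d9
    linarith
  linarith

lemma four_sqrt_exp_le_eight : 4 * √(Real.exp 1) ≤ 8 := by
  have : √(Real.exp 1) ≤ 2 := by
    rw [Real.sqrt_le_left (by norm_num)]
    have := Real.exp_one_lt_d9
    linarith
  linarith

variable {M : ℝ} {T s : ℕ}

lemma le_pulls (M : ℝ) (T s : ℕ) :
    8 * (1 + M) ^ 2 * logTerm T s / theta s ^ 2 ≤ pulls M T s := Nat.le_ceil _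

lemma pulls_pos (hM : 0 ≤ M) (hL : 0 < logTerm T s) : 0 < pulls M T s := by
  have := theta_pos s
  unfold pulls
  exact Nat.ceil_pos.mpr (by positivity)

lemma radius_pos (hM : 0 ≤ M) (hL : 0 < logTerm T s) : 0 < radius M T s := by
  have : (0 : ℝ) < pulls M T s := by exact_mod_cast pulls_pos hM hL
  unfold radius
  positivity

lemma radius_le (hM : 0 ≤ M) (hL : 0 < logTerm T s) : radius M T s ≤ theta s / 2 := by
  have hn : (0 : ℝ) < pulls M T s := by exact_mod_cast pulls_pos hM hL
  have hθ := theta_pos s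
  refine le_of_sq_le_sq ?_ (by positivity)
  unfold radius
  rw [mul_pow, Real.sq_sqrt (by positivity), div_pow, ← mul_div_assoc, div_le_div_iff₀ hn
    (by norm_num)]
  have := le_pulls M T s
  rw [div_le_iff₀ (by positivity)] at this
  nlinarith

/-- Some epoch that is longer than the horizon precedes the degenerate ones. -/
lemma exists_long_epoch (hM : 0 ≤ M) (hT : 1 ≤ T) :
    ∃ s₀, T ≤ pulls M T s₀ ∧ ∀ s ≤ s₀, 0 < logTerm T s := by
  have hT' : (1 : ℝ) ≤ T := by exact_mod_cast hT
  set A := 4 * √(Real.exp 1) with hA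
  have hA6 : 6 ≤ A := six_le_four_sqrt_exp
  -- The witness s₀ is the last epoch with 𝒜Tθ² ≥ 4 > e, so the logarithm is at least 1 up to it.
  -- Then 𝒜Tθ² < 16 at s₀ and 𝒜 ≥ 6, so Tθ² < 8 and the epoch is longer than T.
  have hlim : ∃ s : ℕ, A * T * (1 / 4) ^ s < 4 := by
    obtain ⟨s, hs⟩ := exists_pow_lt_of_lt_one (show 0 < 4 / (A * T) by positivity)
      (show (1 / 4 : ℝ) < 1 by norm_num)
    refine ⟨s, ?_⟩
    rwa [lt_div_iff₀ (by positivity), mul_comm] at hs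
  classical
  have hfind := Nat.find_spec hlim
  have hne : Nat.find hlim ≠ 0 := by
    intro h0
    rw [h0] at hfind
    simp only [pow_zero, mul_one] at hfind
    nlinarith
  obtain ⟨s₀, hs₀⟩ := Nat.exists_eq_succ_of_ne_zero hne
  rw [hs₀] at hfind
  have hle : ∀ s ≤ s₀, 4 ≤ A * T * theta s ^ 2 := by
    intro s hs
    have := Nat.find_min hlim (m := s) (by omega)
    rw [theta_sq]
    exact not_lt.mp this
  have hlog : ∀ s ≤ s₀, 1 ≤ logTerm T s := by
    intro s hs
    unfold logTerm
    rw [Real.le_log_iff_exp_le (by have := hle s hs; linarith)]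
    have := Real.exp_one_lt_d9
    linarith [hle s hs]
  refine ⟨s₀, ?_, fun s hs => by linarith [hlog s hs]⟩
  have h1 := le_pulls M T s₀
  have hθ := theta_pos s₀
  rw [div_le_iff₀ (by positivity)] at h1
  have h2 : A * T * theta s₀ ^ 2 < 16 := by
    rw [theta_sq]
    rw [Nat.succ_eq_add_one, pow_succ] at hfind
    linarith
  have h3 : 8 ≤ 8 * (1 + M) ^ 2 * logTerm T s₀ := by nlinarith [hlog s₀ le_rfl]
  have h4 : (T : ℝ) * theta s₀ ^ 2 ≤ pulls M T s₀ * theta s₀ ^ 2 := by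
    have : 0 < T * theta s₀ ^ 2 := by positivity
    nlinarith
  exact_mod_cast le_of_mul_le_mul_right h4 (by positivity)

end Schedule

/-! ### Deterministic analysis of a run. -/

section Pathwise

variable {K : ℕ} {M : ℝ} {T : ℕ}

/-- Counting: the pulls of the arms of B already fill all |B| n_s positions. -/
lemma PullingOrder.arm_mem {n : ℕ → ℕ} (π : PullingOrder K n) {s : ℕ} {B : Finset (Fin K)} {p : ℕ}
    (hp : p < B.card * n s) : π.arm s B p ∈ B := by
  classical
  have h0 : ∀ i ∈ B, (((Finset.range (B.card * n s)).filter (fun p => π.arm s B p ∈ B)).filter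
      (fun p => π.arm s B p = i)).card = n s := fun i hi => by
    rw [Finset.filter_filter]
    refine Eq.trans (congrArg Finset.card (Finset.filter_congr fun p _ => ?_)) (π.balanced s B i hi)
    exact ⟨fun h => h.2, fun h => ⟨h ▸ hi, h⟩⟩
  have h1 : ((Finset.range (B.card * n s)).filter (fun p => π.arm s B p ∈ B)).card =
      (Finset.range (B.card * n s)).card := by
    rw [Finset.card_eq_sum_card_fiberwise (f := fun p => π.arm s B p) (t := B)
      (fun p hp => by simpa using (Finset.mem_filter.mp hp).2), Finset.sum_congr rfl h0,
      Finset.sum_const, smul_eq_mul, Finset.card_range]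
  have h2 := Finset.eq_of_subset_of_card_le (Finset.filter_subset _ _) h1.ge
  have h3 : p ∈ (Finset.range (B.card * n s)).filter (fun p => π.arm s B p ∈ B) := by
    rw [h2]
    exact Finset.mem_range.mpr hp
  exact (Finset.mem_filter.mp h3).2

variable (π : PullingOrder K (pulls M T)) (x : Fin K → ℕ → ℝ)

lemma epoch_succ_fst (s : ℕ) : (epoch M T π x (s + 1)).1 =
    (epoch M T π x s).1 + (epoch M T π x s).2.card * pulls M T s := rfl

lemma mem_epoch_succ {s : ℕ} {i : Fin K} : i ∈ (epoch M T π x (s + 1)).2 ↔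
    i ∈ (epoch M T π x s).2 ∧ ¬ ∃ j ∈ (epoch M T π x s).2,
      epochAverage π x s (epoch M T π x s).1 (epoch M T π x s).2 i + radius M T s ≤
      epochAverage π x s (epoch M T π x s).1 (epoch M T π x s).2 j - radius M T s := by
  simp only [epoch, Finset.mem_filter]

lemma epoch_start_mono : Monotone fun s => (epoch M T π x s).1 :=
  monotone_nat_of_le_succ fun s => by rw [epoch_succ_fst]; omega

lemma active_antitone : Antitone fun s => (epoch M T π x s).2 :=
  antitone_nat_of_succ_le fun _ _ hi => ((mem_epoch_succ π x).mp hi).1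

lemma one_le_epoch_start (s : ℕ) : 1 ≤ (epoch M T π x s).1 :=
  epoch_start_mono π x (Nat.zero_le s)

/-- The arm with the largest average survives because the radius is positive. -/
lemma active_nonempty (hK : 0 < K) (hM : 0 ≤ M) {s : ℕ} (hL : ∀ u < s, 0 < logTerm T u) :
    (epoch M T π x s).2.Nonempty := by
  induction s with
  | zero => exact ⟨⟨0, hK⟩, by simp [epoch]⟩
  | succ s ih =>
    obtain ⟨i, hi, hmax⟩ := Finset.exists_max_image _
      (epochAverage π x s (epoch M T π x s).1 (epoch M T π x s).2)
      (ih fun u hu => hL u (by omega))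
    refine ⟨i, (mem_epoch_succ π x).mpr ⟨hi, ?_⟩⟩
    rintro ⟨j, hj, h⟩
    have := radius_pos hM (hL s (by omega))
    linarith [hmax j hj]

/-- Justifies that `epochAt` searches only indices up to t. -/
lemma succ_le_epoch_start (hK : 0 < K) (hM : 0 ≤ M) {s : ℕ} (hL : ∀ u < s, 0 < logTerm T u) :
    s + 1 ≤ (epoch M T π x s).1 := by
  induction s with
  | zero => exact one_le_epoch_start π x 0
  | succ s ih =>
    have h1 := ih fun u hu => hL u (by omega)
    have h2 : 0 < (epoch M T π x s).2.card * pulls M T s := Nat.mul_pos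
      (active_nonempty π x hK hM fun u hu => hL u (by omega)).card_pos
      (pulls_pos hM (hL s (by omega)))
    rw [epoch_succ_fst]
    omega

/-- The epoch of a time `t` up to the horizon contains `t`, and no epoch up to it is degenerate. -/
lemma epochAt_spec (hK : 0 < K) (hM : 0 ≤ M) {t : ℕ} (ht : 1 ≤ t) (htT : t ≤ T) :
    (epoch M T π x (epochAt M T π x t)).1 ≤ t ∧
    t < (epoch M T π x (epochAt M T π x t + 1)).1 ∧
    ∀ s ≤ epochAt M T π x t, 0 < logTerm T s := by
  obtain ⟨s₀, hs₀, hL⟩ := exists_long_epoch (T := T) hM (ht.trans htT)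
  have h1 : (epoch M T π x (epochAt M T π x t)).1 ≤ t :=
    Nat.findGreatest_spec (P := fun s => (epoch M T π x s).1 ≤ t) (Nat.zero_le t) ht
  have hlong : T < (epoch M T π x (s₀ + 1)).1 := by
    have h2 := (active_nonempty π x hK hM (s := s₀) fun u hu => hL u hu.le).card_pos
    have h3 := one_le_epoch_start π x s₀
    rw [epoch_succ_fst]
    nlinarith
  have h2 : epochAt M T π x t ≤ s₀ := by
    by_contra h
    have : (epoch M T π x (s₀ + 1)).1 ≤ (epoch M T π x (epochAt M T π x t)).1 :=
      epoch_start_mono π x (by omega)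
    omega
  have hL' : ∀ s ≤ epochAt M T π x t, 0 < logTerm T s := fun s hs => hL s (hs.trans h2)
  refine ⟨h1, ?_, hL'⟩
  have h3 := succ_le_epoch_start π x hK hM (s := epochAt M T π x t) fun u hu => hL' u hu.le
  exact not_le.mp (Nat.findGreatest_is_greatest (P := fun s => (epoch M T π x s).1 ≤ t)
    (Nat.lt_succ_self _) (by omega))

lemma improvedUCB_mem (hK : 0 < K) (hM : 0 ≤ M) {t : ℕ} (ht : 1 ≤ t) (htT : t ≤ T) :
    improvedUCB M T π x t ∈ (epoch M T π x (epochAt M T π x t)).2 := by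
  obtain ⟨h1, h2, _⟩ := epochAt_spec π x hK hM ht htT
  rw [epoch_succ_fst] at h2
  exact π.arm_mem (by omega)

/-- Epoch `s` ends before the horizon, and the average of some active arm `i` is not within the
confidence radius of `μ i`. -/
def BadEpoch (μ : Fin K → ℝ) (s : ℕ) : Prop :=
  (epoch M T π x (s + 1)).1 ≤ T ∧ ∃ i ∈ (epoch M T π x s).2, radius M T s ≤
    |epochAverage π x s (epoch M T π x s).1 (epoch M T π x s).2 i - μ i|

variable {μ : Fin K → ℝ} {best : Fin K}

/-- If all averages are within the radius Ω_u, no arm beats the best one by 2Ω_u, and a survivor has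
gap below 4Ω_u ≤ 2θ_u = 4θ_{u+1}. -/
lemma active_gap_le (hM : 0 ≤ M) (hbest : ∀ i, μ i ≤ μ best) (hμ : ∀ i, μ i ∈ Set.Icc (0 : ℝ) 1)
    {u : ℕ} (hL : ∀ s < u, 0 < logTerm T s) (hgood : ∀ s < u, ¬ BadEpoch π x μ s)
    (hu : (epoch M T π x u).1 ≤ T) :
    best ∈ (epoch M T π x u).2 ∧ ∀ i ∈ (epoch M T π x u).2, μ best - μ i ≤ 4 * theta u := by
  induction u with
  | zero =>
    refine ⟨by simp [epoch], fun i _ => ?_⟩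
    have h1 := (hμ best).2
    have h2 := (hμ i).1
    simp only [theta, pow_zero]
    linarith
  | succ u ih =>
    have hu' : (epoch M T π x u).1 ≤ T := (epoch_start_mono π x (Nat.le_succ u)).trans hu
    obtain ⟨ih1, -⟩ := ih (fun s hs => hL s (by omega)) (fun s hs => hgood s (by omega)) hu'
    have hdev : ∀ i ∈ (epoch M T π x u).2,
        |epochAverage π x u (epoch M T π x u).1 (epoch M T π x u).2 i - μ i| < radius M T u := by
      intro i hi
      by_contra h
      exact hgood u (Nat.lt_succ_self u) ⟨hu, i, hi, not_lt.mp h⟩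
    have hb := abs_lt.mp (hdev best ih1)
    constructor
    · refine (mem_epoch_succ π x).mpr ⟨ih1, ?_⟩
      rintro ⟨j, hj, h⟩
      have hj' := abs_lt.mp (hdev j hj)
      linarith [hbest j, hj'.2, hb.1]
    · intro i hi
      obtain ⟨hi1, hi2⟩ := (mem_epoch_succ π x).mp hi
      have hi' := abs_lt.mp (hdev i hi1)
      push Not at hi2
      have h1 := hi2 best ih1
      have h2 := radius_le hM (hL u (Nat.lt_succ_self u))
      rw [theta_succ]
      linarith [hi'.2, hb.1]

open Classical in
/-- The regret of a single pull. -/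
lemma gap_improvedUCB_le (hK : 0 < K) (hM : 0 ≤ M) (hbest : ∀ i, μ i ≤ μ best)
    (hμ : ∀ i, μ i ∈ Set.Icc (0 : ℝ) 1) (S : ℕ) {t : ℕ} (ht : 1 ≤ t) (htT : t ≤ T) :
    μ best - μ (improvedUCB M T π x t) ≤ 4 * theta S
      + ∑ s ∈ Finset.range S, 4 * theta s * (if epochAt M T π x t = s then 1 else 0)
      + ∑ s ∈ Finset.range S, 4 * theta s * (if BadEpoch π x μ s then 1 else 0) := by
  obtain ⟨h1, h2, hL⟩ := epochAt_spec π x hK hM ht htT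
  have hmem := improvedUCB_mem π x hK hM ht htT
  set e := epochAt M T π x t with he
  have key : ∀ u ≤ e, (∀ s < u, ¬ BadEpoch π x μ s) →
      μ best - μ (improvedUCB M T π x t) ≤ 4 * theta u := fun u hu hg =>
    (active_gap_le π x hM hbest hμ (fun s hs => hL s (by omega)) hg
      ((epoch_start_mono π x hu).trans (h1.trans htT))).2 _ (active_antitone π x hu hmem)
  have hθ := fun s => (theta_pos s).le
  have n1 : ∀ s ∈ Finset.range S, 0 ≤ 4 * theta s * (if e = s then 1 else 0 : ℝ) := fun s _ => by
    have := hθ s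
    positivity
  have n2 : ∀ s ∈ Finset.range S,
      0 ≤ 4 * theta s * (if BadEpoch π x μ s then 1 else 0 : ℝ) := fun s _ => by
    have := hθ s
    positivity
  have s1 := Finset.sum_nonneg n1
  have s2 := Finset.sum_nonneg n2
  -- Before the first bad epoch the gap bound still holds, so a pull after it is charged at the
  -- scale of that epoch. Without a bad epoch, the charge is at the scale of the current epoch or of
  -- S, whichever is earlier.
  by_cases hbad : ∃ s, s < min e S ∧ BadEpoch π x μ s
  · obtain ⟨hf1, hf2⟩ := Nat.find_spec hbad
    have h3 := key (Nat.find hbad) (by omega) fun s hs hb =>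
      Nat.find_min hbad hs ⟨by omega, hb⟩
    have h4 := Finset.single_le_sum n2 (Finset.mem_range.mpr (show Nat.find hbad < S by omega))
    rw [if_pos hf2, mul_one] at h4
    linarith [hθ S]
  · have hg : ∀ s < min e S, ¬ BadEpoch π x μ s := fun s hs hb => hbad ⟨s, hs, hb⟩
    rcases lt_or_ge e S with h | h
    · have h3 := key e le_rfl fun s hs => hg s (by omega)
      have h4 := Finset.single_le_sum n1 (Finset.mem_range.mpr h)
      rw [if_pos rfl, mul_one] at h4
      linarith [hθ S]
    · have h3 := key S h fun s hs => hg s (by omega)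
      linarith

open Classical in
/-- The regret of a run of Improved UCB. -/
lemma sum_gap_improvedUCB_le (hK : 0 < K) (hM : 0 ≤ M) (hbest : ∀ i, μ i ≤ μ best)
    (hμ : ∀ i, μ i ∈ Set.Icc (0 : ℝ) 1) (S : ℕ) :
    ∑ t ∈ Finset.Icc 1 T, (μ best - μ (improvedUCB M T π x t)) ≤ T * (4 * theta S)
      + ∑ s ∈ Finset.range S, 4 * theta s * (K * pulls M T s)
      + ∑ s ∈ Finset.range S, 4 * theta s * T * (if BadEpoch π x μ s then 1 else 0) := by
  refine (Finset.sum_le_sum fun t ht => gap_improvedUCB_le π x hK hM hbest hμ S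
    (Finset.mem_Icc.mp ht).1 (Finset.mem_Icc.mp ht).2).trans ?_
  rw [Finset.sum_add_distrib, Finset.sum_add_distrib, Finset.sum_const, Finset.sum_const,
    Nat.card_Icc, Nat.add_sub_cancel, nsmul_eq_mul, nsmul_eq_mul, Finset.sum_comm]
  refine add_le_add (add_le_add le_rfl (Finset.sum_le_sum fun s _ => ?_)) (le_of_eq ?_)
  · rw [← Finset.mul_sum]
    have := (theta_pos s).le
    refine mul_le_mul_of_nonneg_left ?_ (by positivity)
    rw [Finset.sum_boole]
    have hsub : (Finset.Icc 1 T).filter (fun t => epochAt M T π x t = s) ⊆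
        Finset.Ico (epoch M T π x s).1 (epoch M T π x (s + 1)).1 := by
      intro t ht
      obtain ⟨ht1, ht2⟩ := Finset.mem_filter.mp ht
      obtain ⟨h1, h2, _⟩ := epochAt_spec π x hK hM (Finset.mem_Icc.mp ht1).1
        (Finset.mem_Icc.mp ht1).2
      rw [ht2] at h1 h2
      exact Finset.mem_Ico.mpr ⟨h1, h2⟩
    have hcard := Finset.card_le_card hsub
    rw [Nat.card_Ico, epoch_succ_fst, Nat.add_sub_cancel_left] at hcard
    have h3 : (epoch M T π x s).2.card ≤ K := by
      simpa using Finset.card_le_univ (epoch M T π x s).2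
    exact_mod_cast hcard.trans (Nat.mul_le_mul_right _ h3)
  · rw [Finset.mul_sum]
    refine Finset.sum_congr rfl fun s _ => by ring

end Pathwise

/-! ### Probability of bad epochs and expected regret. -/

section BadEpochs

variable {Ω : Type*} {K : ℕ} {X : Fin K → ℕ → Ω → unitInterval} {M : ℝ} {T : ℕ}
  (π : PullingOrder K (pulls M T))

open Classical in
lemma measurableSet_survivors [MeasurableSpace Ω] {f : Fin K → Ω → ℝ}
    (hf : ∀ i, Measurable (f i)) (B B' : Finset (Fin K)) (r : ℝ) :
    MeasurableSet {ω | B.filter (fun i => ¬ ∃ j ∈ B, f i ω + r ≤ f j ω - r) = B'} := by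
  simp only [Finset.ext_iff, Finset.mem_filter]
  refine measurableSet_setOfPred.mpr (Measurable.forall fun i => Measurable.iff ?_ measurable_const)
  refine measurable_const.and (Measurable.not (Measurable.exists fun j => measurable_const.and ?_))
  exact measurableSet_setOfPred.mp
    (measurableSet_le ((hf i).add_const r) ((hf j).sub_const r))

/-- The start of an epoch is a stopping time: it and the active set are functions of earlier
rewards. This allows conditioning on them in the deviation bound. -/
lemma measurableSet_epoch_eq (s : ℕ) : ∀ (t : ℕ) (B : Finset (Fin K)),
    MeasurableSet[history X (t - 1)]
      {ω | epoch M T π (fun k t' => (X k t' ω : ℝ)) s = (t, B)} := by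
  induction s with
  | zero =>
    exact fun t B => @MeasurableSet.const Ω (history X (t - 1))
      (((1, Finset.univ) : ℕ × Finset (Fin K)) = (t, B))
  | succ s ih =>
    classical
    intro t' B'
    have hset : {ω | epoch M T π (fun k t' => (X k t' ω : ℝ)) (s + 1) = (t', B')} =
        ⋃ t ∈ Finset.Icc 1 t', ⋃ B ∈ Finset.univ.filter
          (fun B : Finset (Fin K) => t + B.card * pulls M T s = t'),
          ({ω | epoch M T π (fun k t' => (X k t' ω : ℝ)) s = (t, B)} ∩
          {ω | B.filter (fun i => ¬ ∃ j ∈ B,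
            epochAverage π (fun k t' => (X k t' ω : ℝ)) s t B i + radius M T s ≤
            epochAverage π (fun k t' => (X k t' ω : ℝ)) s t B j - radius M T s) = B'}) := by
      ext ω
      simp only [Set.mem_iUnion, Finset.mem_filter, Finset.mem_univ, true_and, Set.mem_inter_iff,
        Set.mem_ofPred_eq, exists_prop, Finset.mem_Icc]
      constructor
      · intro h
        have h1 : (epoch M T π (fun k t' => (X k t' ω : ℝ)) (s + 1)).1 = t' := congrArg Prod.fst h
        have h2 : (epoch M T π (fun k t' => (X k t' ω : ℝ)) (s + 1)).2 = B' := congrArg Prod.snd h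
        rw [epoch_succ_fst] at h1
        refine ⟨(epoch M T π (fun k t' => (X k t' ω : ℝ)) s).1, ⟨one_le_epoch_start π _ s, ?_⟩,
          (epoch M T π (fun k t' => (X k t' ω : ℝ)) s).2, h1, rfl, ?_⟩
        · omega
        · rw [← h2]
          ext i
          rw [mem_epoch_succ, Finset.mem_filter]
      · rintro ⟨t, ht, B, hB, h1, h2⟩
        refine Prod.ext ?_ ?_
        · rw [epoch_succ_fst, h1]
          exact hB
        · rw [← h2]
          ext i
          rw [mem_epoch_succ, Finset.mem_filter, h1]
    rw [hset]
    -- Epoch s occupies the times t, …, t' - 1, so its averages are measurable for this history.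
    let _ : MeasurableSpace Ω := history X (t' - 1)
    refine Finset.measurableSet_biUnion _ fun t ht => Finset.measurableSet_biUnion _ fun B hB => ?_
    have ht1 := Finset.mem_Icc.mp ht
    have hB1 := (Finset.mem_filter.mp hB).2
    refine MeasurableSet.inter (history_mono (by omega) _ (ih t B)) ?_
    refine measurableSet_survivors (fun i => ?_) B B' (radius M T s)
    unfold epochAverage
    refine Measurable.div_const (Finset.measurable_sum _ fun p hp => ?_) _
    have hp1 := Finset.mem_range.mp (Finset.mem_filter.mp hp).1
    exact measurable_history_coe (by omega) (by omega)

variable [m0 : MeasurableSpace Ω] {P : Measure Ω}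

/-- The deviation bound carries the factor P(E b), and these probabilities sum to at most 1, so the
many possible starts and active sets cost nothing. -/
lemma measure_badEpoch_le [IsProbabilityMeasure P] {C : TestClass} {α c : ℝ}
    (hα : 1 / 2 < α) (hc : IsDependenceConstant α c)
    (hC : (fun y : unitInterval => (y : ℝ)) ∈ C.unitBall) (hX : ∀ k t, Measurable (X k t))
    (hW : WeaklyStationary P X T) (hmix : MixesAtRate P C X T α)
    (hMc : M = depFactor α c) {s : ℕ} (hL : 1 / 2 ≤ logTerm T s) :
    P.real {ω | BadEpoch π (fun k t' => (X k t' ω : ℝ)) (armMean P X) s} ≤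
      2 * K * Real.exp (-logTerm T s) := by
  have hM : 0 ≤ M := by
    rw [hMc]
    linarith [eighty_le_depFactor hα hc]
  have hpulls : 0 < pulls M T s := pulls_pos hM (by linarith)
  set E : ℕ × Finset (Fin K) → Set Ω :=
    fun b => {ω | epoch M T π (fun k t' => (X k t' ω : ℝ)) s = b} with hE
  have hEmeas : ∀ b, MeasurableSet (E b) := fun b =>
    history_le hX _ _ (measurableSet_epoch_eq π s b.1 b.2)
  set D : ℕ × Finset (Fin K) → Fin K → Set Ω := fun b i => E b ∩ {ω | radius M T s ≤
    |epochAverage π (fun k t' => (X k t' ω : ℝ)) s b.1 b.2 i - armMean P X i|} with hD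
  set I := (Finset.Icc 1 T ×ˢ (Finset.univ : Finset (Finset (Fin K)))).filter
    (fun b => b.1 + b.2.card * pulls M T s ≤ T) with hI
  have hsub : {ω | BadEpoch π (fun k t' => (X k t' ω : ℝ)) (armMean P X) s} ⊆
      ⋃ b ∈ I, ⋃ i ∈ b.2, D b i := by
    rintro ω ⟨h1, i, hi, h2⟩
    rw [epoch_succ_fst] at h1
    simp only [Set.mem_iUnion]
    refine ⟨epoch M T π (fun k t' => (X k t' ω : ℝ)) s, ?_, i, hi, rfl, h2⟩
    refine Finset.mem_filter.mpr ⟨Finset.mem_product.mpr ⟨Finset.mem_Icc.mpr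
      ⟨one_le_epoch_start π _ s, ?_⟩, Finset.mem_univ _⟩, h1⟩
    omega
  have hDle : ∀ b ∈ I, ∀ i ∈ b.2, P.real (D b i) ≤
      2 * Real.exp (-logTerm T s) * P.real (E b) := by
    intro b hb i hi
    obtain ⟨hb1, hb2⟩ := Finset.mem_filter.mp hb
    have hb3 := Finset.mem_Icc.mp (Finset.mem_product.mp hb1).1
    have hcard := π.balanced s b.2 i hi
    have := measure_average_deviation_le (P := P) hα hc hC hX hW hmix i hb3.1
      (Q := (Finset.range (b.2.card * pulls M T s)).filter (fun p => π.arm s b.2 p = i))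
      (fun p hp => by
        have hp1 := Finset.mem_range.mp (Finset.mem_filter.mp hp).1
        omega) (by rw [hcard]; exact hpulls)
      (measurableSet_epoch_eq π s b.1 b.2) hL
    rw [hcard, ← hMc] at this
    exact this
  have hsum : ∑ b ∈ I, P.real (E b) ≤ 1 := by
    rw [← measureReal_biUnion_finset (fun a _ b _ hab => ?_) (fun b _ => hEmeas b)]
    · exact measureReal_le_one
    · refine Set.disjoint_left.mpr fun ω h1 h2 => hab ?_
      have h1' : epoch M T π (fun k t' => (X k t' ω : ℝ)) s = a := h1
      exact h1'.symm.trans h2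
  calc P.real {ω | BadEpoch π (fun k t' => (X k t' ω : ℝ)) (armMean P X) s}
      ≤ P.real (⋃ b ∈ I, ⋃ i ∈ b.2, D b i) :=
        measureReal_mono hsub (measure_ne_top _ _)
    _ ≤ ∑ b ∈ I, P.real (⋃ i ∈ b.2, D b i) := measureReal_biUnion_finset_le _ _
    _ ≤ ∑ b ∈ I, 2 * K * Real.exp (-logTerm T s) * P.real (E b) := by
        refine Finset.sum_le_sum fun b hb => ?_
        refine (measureReal_biUnion_finset_le _ _).trans ?_
        refine (Finset.sum_le_card_nsmul _ _ _ (hDle b hb)).trans ?_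
        rw [nsmul_eq_mul]
        have hcard : ((b.2.card : ℕ) : ℝ) ≤ K := by
          exact_mod_cast (by simpa using Finset.card_le_univ b.2)
        calc _ ≤ (K : ℝ) * (2 * Real.exp (-logTerm T s) * P.real (E b)) := by gcongr
          _ = _ := by ring
    _ = 2 * K * Real.exp (-logTerm T s) * ∑ b ∈ I, P.real (E b) := by rw [Finset.mul_sum]
    _ ≤ 2 * K * Real.exp (-logTerm T s) := mul_le_of_le_one_right (by positivity) hsum

lemma pseudoRegret_le [IsProbabilityMeasure P] {C : TestClass} {α c : ℝ}
    (hK : 0 < K) (hα : 1 / 2 < α) (hc : IsDependenceConstant α c)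
    (hC : (fun y : unitInterval => (y : ℝ)) ∈ C.unitBall) (hX : ∀ k t, Measurable (X k t))
    (hW : WeaklyStationary P X T) (hmix : MixesAtRate P C X T α)
    (hMc : M = depFactor α c) {S : ℕ}
    (hL : ∀ s < S, 1 / 2 ≤ logTerm T s) :
    pseudoRegret P X T (fun t ω => improvedUCB M T π
      (fun k t' => (X k t' ω : ℝ)) t) ≤ T * (4 * theta S)
      + ∑ s ∈ Finset.range S, 4 * theta s * (K * pulls M T s)
      + ∑ s ∈ Finset.range S, 4 * theta s * T * (2 * K * Real.exp (-logTerm T s)) := by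
  classical
  have hM : 0 ≤ M := by
    rw [hMc]
    linarith [eighty_le_depFactor hα hc]
  have : Nonempty (Fin K) := ⟨⟨0, hK⟩⟩
  obtain ⟨best, hbest⟩ := exists_eq_ciSup_of_finite (f := armMean P X)
  have hle : ∀ i, armMean P X i ≤ armMean P X best := fun i => by
    rw [hbest]
    exact le_ciSup (Set.finite_range _).bddAbove i
  -- Measurable hulls have the same probability and make measurability of the bad events
  -- unnecessary.
  set bad : ℕ → Set Ω := fun s => toMeasurable P
    {ω | BadEpoch π (fun k t' => (X k t' ω : ℝ)) (armMean P X) s} with hbad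
  have hbadm : ∀ s, MeasurableSet (bad s) := fun s => measurableSet_toMeasurable _ _
  have hbadP : ∀ s, P.real (bad s) =
      P.real {ω | BadEpoch π (fun k t' => (X k t' ω : ℝ)) (armMean P X) s} := fun s => by
    simp only [hbad, measureReal_def, measure_toMeasurable]
  have hint : ∀ s ∈ Finset.range S, Integrable
      (fun ω => 4 * theta s * T * (bad s).indicator (fun _ => (1 : ℝ)) ω) P := fun s _ =>
    ((integrable_const (1 : ℝ)).indicator (hbadm s)).const_mul _
  unfold pseudoRegret
  rw [← hbest]
  calc ∫ ω, ∑ t ∈ Finset.Icc 1 T, (armMean P X best -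
        armMean P X (improvedUCB M T π (fun k t' => (X k t' ω : ℝ)) t)) ∂P
      ≤ ∫ ω, (T * (4 * theta S)
        + ∑ s ∈ Finset.range S, 4 * theta s * (K * pulls M T s)
        + ∑ s ∈ Finset.range S, 4 * theta s * T * (bad s).indicator (fun _ => (1 : ℝ)) ω) ∂P := by
        -- The regret is nonnegative, so only its majorant has to be integrable.
        refine integral_mono_of_nonneg (ae_of_all _ fun ω => Finset.sum_nonneg fun t _ =>
          sub_nonneg.mpr (hle _)) ((integrable_const _).add (integrable_finsetSum _ hint))
          (ae_of_all _ fun ω => ?_)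
        refine (sum_gap_improvedUCB_le π (fun k t' => (X k t' ω : ℝ)) hK hM hle
          (fun i => armMean_mem_Icc hX i) S).trans ?_
        refine add_le_add le_rfl (Finset.sum_le_sum fun s _ => ?_)
        have := theta_pos s
        refine mul_le_mul_of_nonneg_left ?_ (by positivity)
        split_ifs with h
        · have : ω ∈ bad s := subset_toMeasurable P _ h
          simp [this]
        · exact Set.indicator_nonneg (fun _ _ => zero_le_one) _
    _ = T * (4 * theta S)
        + ∑ s ∈ Finset.range S, 4 * theta s * (K * pulls M T s)
        + ∑ s ∈ Finset.range S, 4 * theta s * T * P.real (bad s) := by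
        rw [integral_add (integrable_const _) (integrable_finsetSum _ hint),
          integral_finsetSum _ hint]
        simp only [integral_const, probReal_univ, integral_const_mul,
          integral_indicator (hbadm _), measureReal_restrict_apply_univ, smul_eq_mul, mul_one, one_mul]
    _ ≤ _ := by
        refine add_le_add le_rfl (Finset.sum_le_sum fun s hs => ?_)
        have := theta_pos s
        rw [hbadP]
        exact mul_le_mul_of_nonneg_left (measure_badEpoch_le π hα hc hC hX hW hmix hMc
          (hL s (Finset.mem_range.mp hs))) (by positivity)

end BadEpochs

/-! ### Choice of the cutoff and summation over epochs. -/

section Tuning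

variable {K T : ℕ}

lemma log_natCast_ge (hK : 2 ≤ K) : (69 / 100 : ℝ) ≤ Real.log K := by
  have h1 : Real.log 2 ≤ Real.log K :=
    Real.log_le_log (by norm_num) (by exact_mod_cast hK)
  linarith [Real.log_two_gt_d9]

/-- With l = log K this says l ≤ 4(l + log l). Although log l may be negative, log l ≥ 1 - 1/l ≥
-3l/4 for l ≥ log 2. -/
lemma sqrt_log_le (hK : 2 ≤ K) :
    √(Real.log K) ≤ 4 * (Real.log (K * Real.log K) / √(Real.log K)) := by
  have hl : Real.log 2 ≤ Real.log K := Real.log_le_log (by norm_num) (by exact_mod_cast hK)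
  have h2 := Real.log_two_gt_d9
  have hK0 : (0 : ℝ) < K := by exact_mod_cast (by omega : 0 < K)
  set l := Real.log K with hldef
  have hl0 : 0 < l := by linarith
  rw [← mul_div_assoc, le_div_iff₀ (Real.sqrt_pos.mpr hl0), Real.mul_self_sqrt hl0.le,
    Real.log_mul hK0.ne' hl0.ne', ← hldef]
  have h3 := Real.one_sub_inv_le_log_of_pos hl0
  have h4 : l⁻¹ ≤ 1 + 3 / 4 * l := by
    rw [inv_eq_one_div, div_le_iff₀ hl0]
    nlinarith
  linarith

/-- The logarithms grow linearly as s moves back from S while the costs decay geometrically, so the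
last epochs dominate. -/
lemma sum_two_pow_mul_le (S : ℕ) :
    ∑ s ∈ Finset.range S, (2 : ℝ) ^ s * (1 + ((S : ℝ) - s)) ≤ 3 * 2 ^ S ∧
    ∑ s ∈ Finset.range S, (2 : ℝ) ^ s ≤ 2 ^ S := by
  induction S with
  | zero => simp
  | succ S ih =>
    obtain ⟨h1, h2⟩ := ih
    rw [Finset.sum_range_succ, Finset.sum_range_succ]
    have e : ∑ s ∈ Finset.range S, (2 : ℝ) ^ s * (1 + (((S + 1 : ℕ) : ℝ) - s)) =
        ∑ s ∈ Finset.range S, (2 : ℝ) ^ s * (1 + ((S : ℝ) - s)) +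
          ∑ s ∈ Finset.range S, (2 : ℝ) ^ s := by
      rw [← Finset.sum_add_distrib]
      refine Finset.sum_congr rfl fun s _ => ?_
      push_cast
      ring
    rw [e, pow_succ]
    push_cast
    constructor <;> linarith

/-- The epoch after which the gaps of the active arms are of the order `√(K log K / T)`. -/
lemma exists_cutoff (hK : 2 ≤ K) (hKT : K * Real.log K ≤ T) :
    ∃ S : ℕ, K * Real.log K ≤ T * theta S ^ 2 ∧ T * theta S ^ 2 ≤ 4 * (K * Real.log K) := by
  have hl := log_natCast_ge hK
  have hK0 : (0 : ℝ) < K := by exact_mod_cast (by omega : 0 < K)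
  have hpos : 0 < K * Real.log K := mul_pos hK0 (by linarith)
  have hT0 : (0 : ℝ) < T := by linarith
  -- S is the last index with Tθ_S² ≥ K log K; θ² drops by a factor 4 per epoch.
  have hlim : ∃ s : ℕ, T * (1 / 4 : ℝ) ^ s < K * Real.log K := by
    obtain ⟨s, hs⟩ := exists_pow_lt_of_lt_one (show 0 < K * Real.log K / T by positivity)
      (show (1 / 4 : ℝ) < 1 by norm_num)
    refine ⟨s, ?_⟩
    rwa [lt_div_iff₀ hT0, mul_comm] at hs
  classical
  have hfind := Nat.find_spec hlim
  have hne : Nat.find hlim ≠ 0 := by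
    intro h0
    rw [h0] at hfind
    simp only [pow_zero, mul_one] at hfind
    linarith
  obtain ⟨S, hS⟩ := Nat.exists_eq_succ_of_ne_zero hne
  have h1 := Nat.find_min hlim (m := S) (by omega)
  rw [hS, Nat.succ_eq_add_one, pow_succ] at hfind
  refine ⟨S, ?_, ?_⟩
  · rw [theta_sq]
    exact not_lt.mp h1
  · rw [theta_sq]
    linarith

lemma two_pow_mul_theta (s : ℕ) : 2 ^ s * theta s = 1 := by
  unfold theta
  rw [← mul_pow]
  norm_num

lemma eight_le_mul_theta {S s : ℕ} (hK : 2 ≤ K) (hS : K * Real.log K ≤ T * theta S ^ 2)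
    (hs : s ≤ S) : 8 ≤ 4 * √(Real.exp 1) * T * theta s ^ 2 := by
  have hl := log_natCast_ge hK
  have hK0 : (2 : ℝ) ≤ K := by exact_mod_cast hK
  have h1 : theta S ^ 2 ≤ theta s ^ 2 := by
    rw [theta_sq, theta_sq]
    exact pow_le_pow_of_le_one (by norm_num) (by norm_num) hs
  have h2 : (T : ℝ) * theta S ^ 2 ≤ T * theta s ^ 2 := by gcongr
  have h3 : (138 / 100 : ℝ) ≤ T * theta s ^ 2 := by nlinarith
  have h4 := six_le_four_sqrt_exp
  rw [mul_assoc]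
  nlinarith

lemma one_le_logTerm {S s : ℕ} (hK : 2 ≤ K) (hS : K * Real.log K ≤ T * theta S ^ 2)
    (hs : s ≤ S) : 1 ≤ logTerm T s := by
  have h := eight_le_mul_theta hK hS hs
  unfold logTerm
  rw [Real.le_log_iff_exp_le (by linarith)]
  linarith [Real.exp_one_lt_d9]

/-- The argument of the logarithm is at most 2^5 K² 4^(S-s), and log 2 ≤ log K. -/
lemma logTerm_le {S s : ℕ} (hK : 2 ≤ K) (hS : K * Real.log K ≤ T * theta S ^ 2)
    (hS' : T * theta S ^ 2 ≤ 4 * (K * Real.log K)) (hs : s ≤ S) :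
    logTerm T s ≤ 8 * Real.log K * (1 + ((S : ℝ) - s)) := by
  have hl := log_natCast_ge hK
  have hK0 : (0 : ℝ) < K := by exact_mod_cast (by omega : 0 < K)
  have hlK : Real.log K ≤ K := by
    have := Real.log_le_sub_one_of_pos hK0
    linarith
  have h := eight_le_mul_theta hK hS hs
  have e : theta s ^ 2 = theta S ^ 2 * 4 ^ (S - s) := by
    rw [theta_sq, theta_sq]
    conv_rhs => rw [show S = s + (S - s) by omega, pow_add, Nat.add_sub_cancel_left, mul_assoc,
      ← mul_pow]
    norm_num
  have h1 : 4 * √(Real.exp 1) * T * theta s ^ 2 ≤ 2 ^ 5 * (K * K) * (4 : ℝ) ^ (S - s) := by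
    have h4 : T * theta S ^ 2 ≤ 4 * (K * K) := hS'.trans (by gcongr)
    calc 4 * √(Real.exp 1) * (T : ℝ) * theta s ^ 2
        = 4 * √(Real.exp 1) * (T * theta S ^ 2) * (4 : ℝ) ^ (S - s) := by rw [e]; ring
      _ ≤ 8 * (4 * ((K : ℝ) * K)) * (4 : ℝ) ^ (S - s) := by
        gcongr
        exact four_sqrt_exp_le_eight
      _ = _ := by ring
  have h2 : logTerm T s ≤ 5 * Real.log 2 + (Real.log K + Real.log K)
      + ((S : ℝ) - s) * (2 * Real.log 2) := by
    unfold logTerm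
    refine (Real.log_le_log (by linarith) h1).trans (le_of_eq ?_)
    rw [Real.log_mul (by positivity) (by positivity), Real.log_mul (by positivity) (by positivity),
      Real.log_mul hK0.ne' hK0.ne', Real.log_pow, Real.log_pow,
      show (4 : ℝ) = 2 ^ 2 by norm_num, Real.log_pow, Nat.cast_sub hs]
    norm_num
  have h3 : Real.log 2 ≤ Real.log K := Real.log_le_log (by norm_num) (by exact_mod_cast hK)
  have h4 : (0 : ℝ) ≤ (S : ℝ) - s := sub_nonneg.mpr (by exact_mod_cast hs)
  nlinarith [mul_nonneg h4 (sub_nonneg.mpr h3)]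

/-- With the right number of epochs, the regret decomposition is of the order `√(K T log K)`. -/
lemma exists_regret_decomposition_le (hK : 2 ≤ K) {M : ℝ} (hM : 0 ≤ M) :
    ∃ S : ℕ, (∀ s < S, 1 / 2 ≤ logTerm T s) ∧
      T * (4 * theta S) + ∑ s ∈ Finset.range S, 4 * theta s * (K * pulls M T s)
      + ∑ s ∈ Finset.range S, 4 * theta s * T * (2 * K * Real.exp (-logTerm T s))
      ≤ 800 * (1 + M) ^ 2 * √(K * T * Real.log K) := by
  have hl := log_natCast_ge hK
  have hK0 : (0 : ℝ) < K := by exact_mod_cast (by omega : 0 < K)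
  set l := Real.log K with hldef
  have hl0 : 0 < l := by linarith
  set W := √(K * T * l) with hW
  have hW0 : 0 ≤ W := Real.sqrt_nonneg _
  have hM1 : 1 ≤ (1 + M) ^ 2 := one_le_pow₀ (by linarith)
  have hMW : W ≤ (1 + M) ^ 2 * W := le_mul_of_one_le_left hW0 hM1
  have hT0 : (0 : ℝ) ≤ T := Nat.cast_nonneg T
  -- For short horizons the trivial bound suffices: T² ≤ KTl gives T ≤ W.
  rcases lt_or_ge (T : ℝ) (K * l) with hlt | hge
  · refine ⟨0, by simp, ?_⟩
    have h1 : (T : ℝ) ≤ W := by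
      refine Real.le_sqrt_of_sq_le ?_
      nlinarith
    simp only [theta, pow_zero, Finset.range_zero, Finset.sum_empty]
    linarith
  · obtain ⟨S, hS, hS'⟩ := exists_cutoff hK hge
    rw [← hldef] at hS hS'
    have hθS := theta_pos S
    refine ⟨S, fun s hs => by linarith [one_le_logTerm hK hS hs.le], ?_⟩
    have hfirst : T * (4 * theta S) ≤ 8 * W := by
      have : T * theta S ≤ 2 * W := by
        refine le_of_sq_le_sq ?_ (by positivity)
        rw [mul_pow 2 W, hW, Real.sq_sqrt (by positivity)]
        nlinarith
      linarith
    have hz : K * l * 2 ^ S ≤ W := by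
      refine Real.le_sqrt_of_sq_le ?_
      have h1 : K * l * (2 ^ S * theta S) ^ 2 ≤ T * theta S ^ 2 := by
        rw [two_pow_mul_theta]
        linarith
      have h2 : K * l * (2 ^ S) ^ 2 ≤ T := by
        rw [mul_pow, ← mul_assoc] at h1
        exact le_of_mul_le_mul_right h1 (by positivity)
      calc (K * l * 2 ^ S) ^ 2 = K * l * (K * l * (2 ^ S) ^ 2) := by ring
        _ ≤ K * l * T := by gcongr
        _ = K * T * l := by ring
    have hz' : K * 2 ^ S ≤ 3 / 2 * W := by
      have : (K : ℝ) * 2 ^ S ≤ 3 / 2 * (K * l * 2 ^ S) := by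
        have : 0 < (K : ℝ) * 2 ^ S := by positivity
        nlinarith
      linarith
    obtain ⟨hg1, hg2⟩ := sum_two_pow_mul_le S
    have hinv : ∀ s, (theta s)⁻¹ = 2 ^ s := fun s =>
      inv_eq_of_mul_eq_one_left (two_pow_mul_theta s)
    -- The failure probability is proportional to 1/(𝒜Tθ_s²), which cancels the factor T and leaves
    -- a multiple of K 2^s.
    have hthird : ∑ s ∈ Finset.range S, 4 * theta s * T * (2 * K * Real.exp (-logTerm T s))
        ≤ 3 * W := by
      calc _ ≤ ∑ s ∈ Finset.range S, 2 * K * (2 : ℝ) ^ s := by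
            refine Finset.sum_le_sum fun s hs => ?_
            have h8 := eight_le_mul_theta hK hS (Finset.mem_range.mp hs).le
            have hθ := theta_pos s
            have hA := six_le_four_sqrt_exp
            unfold logTerm
            rw [Real.exp_neg, Real.exp_log (by linarith), ← hinv]
            set A := 4 * √(Real.exp 1) with hAdef
            have hT1 : (0 : ℝ) < T := by
              rcases hT0.eq_or_lt with h | h
              · rw [← h] at h8; norm_num at h8
              · exact h
            have e : 4 * theta s * T * (2 * K * (A * T * theta s ^ 2)⁻¹) =
                8 / A * K * (theta s)⁻¹ := by
              field_simp
              ring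
            rw [e]
            have : 8 / A ≤ 2 := by
              rw [div_le_iff₀ (by linarith)]
              linarith
            gcongr
        _ = 2 * K * ∑ s ∈ Finset.range S, (2 : ℝ) ^ s := by rw [Finset.mul_sum]
        _ ≤ 2 * K * 2 ^ S := by gcongr
        _ ≤ 3 * W := by linarith
    have hsecond : ∑ s ∈ Finset.range S, 4 * theta s * (K * pulls M T s)
        ≤ 768 * (1 + M) ^ 2 * W + 6 * W := by
      calc _ ≤ ∑ s ∈ Finset.range S, (256 * (1 + M) ^ 2 * (K * l) *
              ((2 : ℝ) ^ s * (1 + ((S : ℝ) - s))) + 4 * K * (2 : ℝ) ^ s) := by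
            refine Finset.sum_le_sum fun s hs => ?_
            have hs' := (Finset.mem_range.mp hs).le
            have hθ := theta_pos s
            have hL0 := one_le_logTerm hK hS hs'
            have hL1 := logTerm_le hK hS hS' hs'
            have hn : (pulls M T s : ℝ) ≤ 8 * (1 + M) ^ 2 * logTerm T s / theta s ^ 2 + 1 :=
              (Nat.ceil_lt_add_one (by positivity)).le
            have hp : theta s ≤ 2 ^ s := (theta_le_one s).trans (one_le_pow₀ (by norm_num))
            calc 4 * theta s * (K * pulls M T s)
                ≤ 4 * theta s * (K * (8 * (1 + M) ^ 2 * logTerm T s / theta s ^ 2 + 1)) := by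
                  gcongr
              _ = 32 * (1 + M) ^ 2 * K * (theta s)⁻¹ * logTerm T s + 4 * K * theta s := by
                  field_simp
                  ring
              _ ≤ 32 * (1 + M) ^ 2 * K * (theta s)⁻¹ * (8 * l * (1 + ((S : ℝ) - s)))
                  + 4 * K * 2 ^ s := by gcongr
              _ = _ := by rw [hinv]; ring
        _ = 256 * (1 + M) ^ 2 * (K * l) *
              ∑ s ∈ Finset.range S, (2 : ℝ) ^ s * (1 + ((S : ℝ) - s))
              + 4 * K * ∑ s ∈ Finset.range S, (2 : ℝ) ^ s := by
            rw [Finset.sum_add_distrib, Finset.mul_sum, Finset.mul_sum]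
        _ ≤ 256 * (1 + M) ^ 2 * (K * l) * (3 * 2 ^ S) + 4 * K * 2 ^ S := by gcongr
        _ = 768 * (1 + M) ^ 2 * (K * l * 2 ^ S) + 4 * (K * 2 ^ S) := by ring
        _ ≤ 768 * (1 + M) ^ 2 * W + 4 * (3 / 2 * W) := by gcongr
        _ = _ := by ring
    -- The three parts give 8 + (768 + 6) + 3 ≤ 800.
    linarith

end Tuning

end MixingBandit

/-! ### The problem-independent regret bound. -/

theorem mainTheorem5 (α : ℝ) (hα : 1 / 2 < α) :
    (∃ c : ℝ, MixingBandit.IsDependenceConstant α c) ∧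
    ∀ c : ℝ, MixingBandit.IsDependenceConstant α c →
      ∃ c' : ℝ, c ≤ c' ∧
        ∀ (K T : ℕ), 2 ≤ K → K < T →
        ∀ (π : MixingBandit.PullingOrder K
            (MixingBandit.pulls (MixingBandit.depFactor α c) T))
          (C : MixingBandit.TestClass), (fun y : unitInterval => (y : ℝ)) ∈ C.unitBall →
        ∀ (Ω : Type*) [MeasurableSpace Ω] (P : Measure Ω) [IsProbabilityMeasure P]
          (X : Fin K → ℕ → Ω → unitInterval),
          (∀ k t, Measurable (X k t)) →
          MixingBandit.WeaklyStationary P X T →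
          MixingBandit.MixesAtRate P C X T α →
          MixingBandit.pseudoRegret P X T
              (fun t ω => MixingBandit.improvedUCB (MixingBandit.depFactor α c) T π
                (fun k t' => (X k t' ω : ℝ)) t)
            ≤ √((1 + MixingBandit.depFactor α c') * K * T)
                * (Real.log (K * Real.log K) / √(Real.log K)) := by
  refine ⟨⟨4, MixingBandit.isDependenceConstant_four α⟩, fun c hc => ?_⟩
  have hM := MixingBandit.eighty_le_depFactor hα hc
  set M := MixingBandit.depFactor α c with hMdef
  -- 3200 = 800 · 4: the tuning constant times the loss in `sqrt_log_le`.
  set D := 3200 * (1 + M) ^ 2 with hD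
  -- The algorithm keeps M(c); only the bound uses the larger constant, and M(c + D²) ≥ 80 D² makes
  -- its square root exceed D.
  refine ⟨c + D ^ 2, le_add_of_nonneg_right (sq_nonneg D), ?_⟩
  intro K T hK hKT π C hC Ω _ P _ X hX hW hmix
  have hD' : D ≤ √(1 + MixingBandit.depFactor α (c + D ^ 2)) := by
    refine Real.le_sqrt_of_sq_le ?_
    have h1 := MixingBandit.one_le_of_isDependenceConstant hc
    have h2 := MixingBandit.one_le_tsum_weights hα
    unfold MixingBandit.depFactor
    nlinarith [sq_nonneg D]
  obtain ⟨S, hS1, hS2⟩ := MixingBandit.exists_regret_decomposition_le (T := T) hK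
    (M := M) (by linarith)
  refine (MixingBandit.pseudoRegret_le π (by omega) hα hc hC hX hW hmix rfl hS1).trans
    (hS2.trans ?_)
  have hlog := MixingBandit.sqrt_log_le hK
  have hl := MixingBandit.log_natCast_ge hK
  set R := Real.log (K * Real.log K) / √(Real.log K) with hR
  have hR0 : 0 ≤ R := by linarith [Real.sqrt_nonneg (Real.log K)]
  have hM0 : 0 ≤ 1 + M := by linarith
  calc 800 * (1 + M) ^ 2 * √(K * T * Real.log K)
      = 800 * (1 + M) ^ 2 * (√(K * T) * √(Real.log K)) := by
        rw [Real.sqrt_mul (by positivity)]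
    _ ≤ 800 * (1 + M) ^ 2 * (√(K * T) * (4 * R)) := by gcongr
    _ = D * √(K * T) * R := by rw [hD]; ring
    _ ≤ √(1 + MixingBandit.depFactor α (c + D ^ 2)) * √(K * T) * R := by gcongr
    _ = √((1 + MixingBandit.depFactor α (c + D ^ 2)) * K * T) * R := by
        rw [← Real.sqrt_mul' _ (by positivity), ← mul_assoc]
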